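/- Let $k\ge 1$ be an integer and put $m=2k-1$, so that $2m=4k-2$. Write $\mathrm{Map}^\ast(X,Y)$ for the space of pointed continuous maps with the compact-open topology, and identify $S^n\cong I^n/\partial I^n$ as pointed spaces for $n\ge1$. Let $$\phi\colon (S^{m})^2\longrightarrow (S^{m})^2\vee S^{2m}$$ be the pinch map that, in coordinates $(u,v)\in I^{m}\times I^{m}$ on the top cell of $(S^{m})^2$, collapses the boundary of the ball $D=\{u_1\le\tfrac12,\ v_1\le\tfrac12\}$ to the wedge point, maps $D$ onto the summand $S^{2m}=I^{2m}/\partial I^{2m}$ by doubling $u_1$ and $v_1$, and maps the complement of $D$ to the summand $(S^{m})^2$ by $u_1\mapsto\max(2u_1-1,0)$, $v_1\mapsto\max(2v_1-1,0)$, the remaining coordinates being unchanged. Let $$\Theta\colon \mathrm{Map}^\ast(S^{4k-2},S^{2k})\times \mathrm{Map}^\ast\big((S^{2k-1})^2,S^{2k}\big)\longrightarrow \mathrm{Map}^\ast\big((S^{2k-1})^2,S^{2k}\big),\qquad \Theta(\alpha,f)=(f,\alpha)\circ\phi ,$$ and let $\star$ be the H-group operation on $\mathrm{Map}^\ast(S^{4k-2},S^{2k})$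 given by concatenation in the first coordinate of the cube $I^{4k-2}$. Then: 1. $\Theta$ is continuous and is an action up to pointed homotopy of this H-group: $\Theta(\mathrm{const},-)\simeq \mathrm{id}$ as pointed self-maps of $\mathrm{Map}^\ast((S^{2k-1})^2,S^{2k})$, and $\Theta(\alpha\star\beta,f)\simeq\Theta(\alpha,\Theta(\beta,f))$ as pointed maps of $(\alpha,\beta,f)\in \mathrm{Map}^\ast(S^{4k-2},S^{2k})^2\times \mathrm{Map}^\ast((S^{2k-1})^2,S^{2k})$, the base points being the constant maps. 2. For each $\alpha\in\mathrm{Map}^\ast(S^{4k-2},S^{2k})$ the map $\Theta(\alpha,-)$ is a homotopy equivalence from $\mathrm{Map}^\ast((S^{2k-1})^2,S^{2k})$ to itself. 3. All connected components of $\mathrm{Map}^\ast((S^{2k-1})^2,S^{2k})$ are homotopy equivalent, through this action: for any two connected components $C,C'$ there is an $\alpha\in\mathrm{Map}^\ast(S^{4k-2},S^{2k})$ such that $\Theta(\alpha,-)$ restricts to a homotopy equivalence $C\to C'$. -/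

import Mathlib

open scoped unitInterval Topology ContinuousMap

noncomputable section

/-! ### Pointed mapping spaces and wedge sums -/

/-- The space of pointed maps `(X, x) → (Y, y)`, with the compact-open topology. -/
abbrev PointedMap (X Y : Type*) [TopologicalSpace X] [TopologicalSpace Y] (x : X) (y : Y) :
    Type _ :=
  {f : C(X, Y) // f x = y}

namespace PointedMap

variable {X Y : Type*} [TopologicalSpace X] [TopologicalSpace Y]

/-- The constant pointed map, the base point of the pointed mapping space. -/
def const (x : X) (y : Y) : PointedMap X Y x y := ⟨ContinuousMap.const X y, rfl⟩

end PointedMap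

/-- The wedge sum `X ∨ Y`: the disjoint union with the two base points identified. -/
def Wedge (X Y : Type*) (x : X) (y : Y) : Type _ :=
  Quot (fun p q : X ⊕ Y => p = Sum.inl x ∧ q = Sum.inr y)

namespace Wedge

variable {X Y Z A : Type*} [TopologicalSpace X] [TopologicalSpace Y] [TopologicalSpace Z]
  [TopologicalSpace A] {x : X} {y : Y} {z : Z} {a : A}

instance : TopologicalSpace (Wedge X Y x y) :=
  inferInstanceAs (TopologicalSpace (Quot _))

/-- The inclusion of the first summand. -/
def inl : C(X, Wedge X Y x y) where
  toFun p := Quot.mk _ (Sum.inl p)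
  continuous_toFun := continuous_quot_mk.comp continuous_inl

/-- The inclusion of the second summand. -/
def inr : C(Y, Wedge X Y x y) where
  toFun p := Quot.mk _ (Sum.inr p)
  continuous_toFun := continuous_quot_mk.comp continuous_inr

theorem inl_base : (inl x : Wedge X Y x y) = inr y := Quot.sound ⟨rfl, rfl⟩

/-- The base point of the wedge sum. -/
def base (x : X) (y : Y) : Wedge X Y x y := inl x

/-- The map `(f, g) : X ∨ Y → A` given by a pair of pointed maps. -/
def desc (f : PointedMap X A x a) (g : PointedMap Y A y a) :
    PointedMap (Wedge X Y x y) A (base x y) a :=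
  ⟨{  toFun := Quot.lift (Sum.elim f.1 g.1) (by
        rintro _ _ ⟨rfl, rfl⟩
        simp [f.2, g.2])
      continuous_toFun := continuous_quot_lift _ (f.1.continuous.sumElim g.1.continuous) },
    f.2⟩

@[simp] theorem desc_inl (f : PointedMap X A x a) (g : PointedMap Y A y a) (p : X) :
    (desc f g).1 (inl p) = f.1 p := rfl

@[simp] theorem desc_inr (f : PointedMap X A x a) (g : PointedMap Y A y a) (q : Y) :
    (desc f g).1 (inr q) = g.1 q := rfl

open Classical in
/-- Two maps `f : Z → X` and `g : Z → Y`, at each point of `Z` at least one of which takes the base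
point as its value, define together a map `Z → X ∨ Y`. It is `f` where `g` is trivial
and `g` where `f` is trivial. -/
def lift [T1Space X] [T1Space Y] (f : C(Z, X)) (g : C(Z, Y)) (h : ∀ p, f p = x ∨ g p = y) :
    C(Z, Wedge X Y x y) where
  toFun p := if g p = y then inl (f p) else inr (g p)
  continuous_toFun := by
    have h1 : IsClosed {p | g p = y} := isClosed_singleton.preimage g.continuous
    have h2 : IsClosed {p | f p = x} := isClosed_singleton.preimage f.continuous
    rw [← continuousOn_univ, show (Set.univ : Set Z) = {p | g p = y} ∪ {p | f p = x} from
      (Set.eq_univ_of_forall fun p => (h p).symm).symm]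
    refine ContinuousOn.union_of_isClosed ?_ ?_ h1 h2
    · refine (inl.continuous.comp f.continuous).continuousOn.congr fun p hp => ?_
      rw [Set.mem_ofPred_eq] at hp
      simp [hp]
    · refine (inr.continuous.comp g.continuous).continuousOn.congr fun p hp => ?_
      rw [Set.mem_ofPred_eq] at hp
      by_cases hq : g p = y
      · simp [hp, hq, inl_base]
      · simp [hq]

section lift

variable [T1Space X] [T1Space Y] (f : C(Z, X)) (g : C(Z, Y)) (h : ∀ p, f p = x ∨ g p = y)

theorem lift_of_right {p : Z} (hp : g p = y) : lift f g h p = inl (f p) := if_pos hp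

theorem lift_of_left {p : Z} (hp : f p = x) : lift f g h p = inr (g p) := by
  by_cases hq : g p = y
  · rw [lift_of_right f g h hq, hp, hq, inl_base]
  · exact if_neg hq

/-- The operation `Map*(X, A) × Map*(Y, A) ≅ Map*(X ∨ Y, A) → Map*(Z, A)` of precomposition with
the pointed map `lift f g h : Z → X ∨ Y`. -/
def pull [LocallyCompactSpace X] [LocallyCompactSpace Y] (hf : f z = x) (hg : g z = y) (a : A) :
    C(PointedMap X A x a × PointedMap Y A y a, PointedMap Z A z a) where
  toFun w := ⟨(desc w.1 w.2).1.comp (lift f g h), by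
    rw [ContinuousMap.comp_apply, lift_of_right f g h hg, hf]
    exact (desc w.1 w.2).2⟩
  continuous_toFun := by
    refine Continuous.subtype_mk (ContinuousMap.continuous_of_continuous_uncurry _ ?_) _
    have h1 : IsClosed
        {q : (PointedMap X A x a × PointedMap Y A y a) × Z | g q.2 = y} :=
      isClosed_singleton.preimage (g.continuous.comp continuous_snd)
    have h2 : IsClosed
        {q : (PointedMap X A x a × PointedMap Y A y a) × Z | f q.2 = x} :=
      isClosed_singleton.preimage (f.continuous.comp continuous_snd)
    have h3 : (Set.univ : Set ((PointedMap X A x a × PointedMap Y A y a) × Z))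
        = {q | g q.2 = y} ∪ {q | f q.2 = x} := by
      ext q
      simpa using (h q.2).symm
    rw [← continuousOn_univ, h3]
    refine ContinuousOn.union_of_isClosed ?_ ?_ h1 h2
    · have hc : Continuous fun q : (PointedMap X A x a × PointedMap Y A y a) × Z =>
          q.1.1.1 (f q.2) := by fun_prop
      refine hc.continuousOn.congr fun q hq => ?_
      rw [Set.mem_ofPred_eq] at hq
      simp [Function.uncurry, lift_of_right f g h hq]
    · have hc : Continuous fun q : (PointedMap X A x a × PointedMap Y A y a) × Z =>
          q.1.2.1 (g q.2) := by fun_prop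
      refine hc.continuousOn.congr fun q hq => ?_
      rw [Set.mem_ofPred_eq] at hq
      simp [Function.uncurry, lift_of_left f g h hq]

end lift

end Wedge

/-! ### Spheres and their cell structure -/

/-- The standard sphere `S^n` in `ℝ^(n+1)`. -/
abbrev Sph (n : ℕ) : Type := Metric.sphere (0 : EuclideanSpace ℝ (Fin (n + 1))) 1

namespace Sph

/-- The base point of `S^n`, the north pole `(0, …, 0, 1)`. -/
def base (n : ℕ) : Sph n := ⟨EuclideanSpace.single (Fin.last n) 1, by simp⟩

variable {n : ℕ}

/-- The coordinate `2 t - 1 ∈ [-1, 1]`. -/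
def ctr (t : I^ (Fin n)) (i : Fin n) : ℝ := 2 * (t i : ℝ) - 1

/-- A function on the cube that is positive in the interior and zero on the boundary. -/
def wt (t : I^ (Fin n)) : ℝ := ∏ i, (1 - ctr t i ^ 2)

/-- The squared norm of the centred coordinates. -/
def nsq (t : I^ (Fin n)) : ℝ := ∑ i, ctr t i ^ 2

theorem ctr_sq_le (t : I^ (Fin n)) (i : Fin n) : ctr t i ^ 2 ≤ 1 := by
  have h0 := (t i).2.1
  have h1 := (t i).2.2
  unfold ctr
  nlinarith

theorem wt_nonneg (t : I^ (Fin n)) : 0 ≤ wt t :=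
  Finset.prod_nonneg fun i _ => by linarith [ctr_sq_le t i]

theorem nsq_nonneg (t : I^ (Fin n)) : 0 ≤ nsq t := Finset.sum_nonneg fun i _ => sq_nonneg _

theorem wt_eq_zero {t : I^ (Fin n)} : wt t = 0 ↔ t ∈ Cube.boundary (Fin n) := by
  unfold wt ctr Cube.boundary
  rw [Finset.prod_eq_zero_iff]
  simp only [Finset.mem_univ, true_and, Set.mem_ofPred_eq]
  refine exists_congr fun i => ?_
  rw [show (1 - (2 * (t i : ℝ) - 1) ^ 2) = 4 * ((t i : ℝ) * (1 - t i)) by ring]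
  simp only [mul_eq_zero, OfNat.ofNat_ne_zero, false_or, sub_eq_zero, Set.Icc.coe_eq_zero]
  rw [eq_comm (a := (1 : ℝ)), Set.Icc.coe_eq_one]

theorem den_pos (t : I^ (Fin n)) : 0 < nsq t + wt t ^ 2 := by
  rcases (nsq_nonneg t).lt_or_eq with h | h
  · positivity
  · have h' : ∀ i, ctr t i ^ 2 = 0 := fun i =>
      (Finset.sum_eq_zero_iff_of_nonneg fun i _ => sq_nonneg _).1 h.symm i (Finset.mem_univ i)
    have : wt t = 1 := by simp [wt, h']
    rw [this, ← h]; norm_num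

theorem continuous_ctr (i : Fin n) : Continuous fun t : I^ (Fin n) => ctr t i := by
  unfold ctr; fun_prop

theorem continuous_wt : Continuous (wt (n := n)) :=
  continuous_finsetProd _ fun i _ => continuous_const.sub ((continuous_ctr i).pow 2)

theorem continuous_nsq : Continuous (nsq (n := n)) :=
  continuous_finsetSum _ fun i _ => (continuous_ctr i).pow 2

/-- The characteristic map `I^n → S^n` of the top cell of `S^n`: inverse stereographic projection
from the north pole, applied to the point `ctr t / wt t ∈ ℝ^n ∪ {∞}`. It maps the
boundary of the cube to the base point and the interior homeomorphically onto the complement. -/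
def cell : C(I^ (Fin n), Sph n) where
  toFun t := ⟨WithLp.toLp 2 (Fin.snoc (α := fun _ => ℝ)
      (fun i => 2 * wt t * ctr t i / (nsq t + wt t ^ 2))
      ((nsq t - wt t ^ 2) / (nsq t + wt t ^ 2))), by
    have hd := (den_pos t).ne'
    rw [mem_sphere_zero_iff_norm, EuclideanSpace.norm_eq, Real.sqrt_eq_one]
    simp only [Real.norm_eq_abs, sq_abs, Fin.sum_univ_castSucc, Fin.snoc_castSucc, Fin.snoc_last]
    have : ∀ i, (2 * wt t * ctr t i / (nsq t + wt t ^ 2)) ^ 2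
        = (2 * wt t / (nsq t + wt t ^ 2)) ^ 2 * ctr t i ^ 2 := fun i => by ring
    simp only [this]
    rw [← Finset.mul_sum, show ∑ i, ctr t i ^ 2 = nsq t from rfl]
    field_simp
    ring⟩
  continuous_toFun := by
    refine Continuous.subtype_mk ((PiLp.continuous_toLp 2 _).comp (continuous_pi fun i => ?_)) _
    have hd : ∀ t : I^ (Fin n), nsq t + wt t ^ 2 ≠ 0 := fun t => (den_pos t).ne'
    have hD : Continuous fun t : I^ (Fin n) => nsq t + wt t ^ 2 :=
      continuous_nsq.add (continuous_wt.pow 2)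
    refine Fin.lastCases ?_ (fun i => ?_) i
    · simp only [Fin.snoc_last]
      exact (continuous_nsq.sub (continuous_wt.pow 2)).div hD hd
    · simp only [Fin.snoc_castSucc]
      exact ((continuous_const.mul continuous_wt).mul (continuous_ctr i)).div hD hd

theorem cell_last (t : I^ (Fin n)) :
    (cell t).1 (Fin.last n) = (nsq t - wt t ^ 2) / (nsq t + wt t ^ 2) := by
  simp [cell]

theorem cell_castSucc (t : I^ (Fin n)) (i : Fin n) :
    (cell t).1 i.castSucc = 2 * wt t * ctr t i / (nsq t + wt t ^ 2) := by
  simp [cell]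

theorem eq_base_iff (y : Sph n) : y = base n ↔ y.1 (Fin.last n) = 1 := by
  constructor
  · rintro rfl; simp [base]
  · intro h
    have hy := y.2
    rw [mem_sphere_zero_iff_norm, EuclideanSpace.norm_eq, Real.sqrt_eq_one] at hy
    simp only [Real.norm_eq_abs, sq_abs, Fin.sum_univ_castSucc, h] at hy
    have h0 : ∑ i : Fin n, y.1 i.castSucc ^ 2 = 0 := by linarith
    have h1 := (Finset.sum_eq_zero_iff_of_nonneg fun i _ => sq_nonneg _).1 h0
    ext i
    refine Fin.lastCases ?_ (fun i => ?_) i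
    · simp [base, h]
    · have := h1 i (Finset.mem_univ i)
      have h2 : y.1 i.castSucc = 0 := by simpa using this
      simp [base, h2, Fin.castSucc_ne_last]

theorem cell_eq_base {t : I^ (Fin n)} : cell t = base n ↔ t ∈ Cube.boundary (Fin n) := by
  rw [eq_base_iff, cell_last, div_eq_one_iff_eq (den_pos t).ne', ← wt_eq_zero]
  constructor
  · intro h
    have : wt t ^ 2 = 0 := by linarith
    simpa using this
  · intro h; simp [h]

theorem cell_inj {s t : I^ (Fin n)} (h : cell s = cell t) :
    s = t ∨ (s ∈ Cube.boundary (Fin n) ∧ t ∈ Cube.boundary (Fin n)) := by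
  by_cases hs : s ∈ Cube.boundary (Fin n)
  · exact Or.inr ⟨hs, cell_eq_base.1 (h ▸ cell_eq_base.2 hs)⟩
  have ht : t ∉ Cube.boundary (Fin n) := fun ht =>
    hs (cell_eq_base.1 (h ▸ cell_eq_base.2 ht))
  left
  have ws : 0 < wt s := lt_of_le_of_ne (wt_nonneg s) fun e => hs (wt_eq_zero.1 e.symm)
  have ws' : 0 < wt t := lt_of_le_of_ne (wt_nonneg t) fun e => ht (wt_eq_zero.1 e.symm)
  have key : ∀ i, wt t * ctr s i = wt s * ctr t i := by
    intro i
    have e1 : (cell s).1 (Fin.last n) = (cell t).1 (Fin.last n) := by rw [h]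
    have e2 : (cell s).1 i.castSucc = (cell t).1 i.castSucc := by rw [h]
    rw [cell_last, cell_last, div_eq_div_iff (den_pos s).ne' (den_pos t).ne'] at e1
    rw [cell_castSucc, cell_castSucc, div_eq_div_iff (den_pos s).ne' (den_pos t).ne'] at e2
    have e3 : wt s ^ 2 * (nsq t + wt t ^ 2) = wt t ^ 2 * (nsq s + wt s ^ 2) := by nlinarith
    have hne : wt s * (nsq t + wt t ^ 2) ≠ 0 := (mul_pos ws (den_pos t)).ne'
    apply mul_left_cancel₀ hne
    linear_combination (wt t / 2) * e2 - ctr t i * e3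
  have mono : ∀ a b : I^ (Fin n), 0 < wt a → 0 < wt b →
      (∀ i, wt b * ctr a i = wt a * ctr b i) → wt a ≤ wt b := by
    intro a b ha hb hk
    by_contra hlt
    rw [not_le] at hlt
    have : wt a ≤ wt b := by
      refine Finset.prod_le_prod (fun i _ => by linarith [ctr_sq_le a i]) fun i _ => ?_
      have h3 : wt b ^ 2 * ctr a i ^ 2 = wt a ^ 2 * ctr b i ^ 2 := by
        rw [← mul_pow, ← mul_pow, hk]
      have h4 : wt b ^ 2 ≤ wt a ^ 2 := by nlinarith
      have h5 : wt b ^ 2 * ctr b i ^ 2 ≤ wt b ^ 2 * ctr a i ^ 2 := by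
        rw [h3]; exact mul_le_mul_of_nonneg_right h4 (sq_nonneg _)
      have := le_of_mul_le_mul_left h5 (by positivity)
      linarith
    linarith
  have hw : wt s = wt t :=
    le_antisymm (mono s t ws ws' key) (mono t s ws' ws fun i => (key i).symm)
  ext i
  have := key i
  rw [hw] at this
  have := mul_left_cancel₀ ws'.ne' this
  unfold ctr at this
  linarith

theorem cell_surjective (hn : n ≠ 0) : Function.Surjective (cell (n := n)) := by
  intro y
  by_cases hy : y = base n
  · refine ⟨fun _ => 0, ?_⟩
    rw [hy, cell_eq_base]
    exact ⟨⟨0, Nat.pos_of_ne_zero hn⟩, Or.inl rfl⟩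
  have hn2 : ∑ i : Fin n, y.1 i.castSucc ^ 2 + y.1 (Fin.last n) ^ 2 = 1 := by
    have := y.2
    rw [mem_sphere_zero_iff_norm, EuclideanSpace.norm_eq, Real.sqrt_eq_one] at this
    simpa only [Real.norm_eq_abs, sq_abs, Fin.sum_univ_castSucc] using this
  set l := y.1 (Fin.last n) with hl
  have hl1 : l ≠ 1 := fun h => hy ((eq_base_iff y).2 h)
  have hl2 : l < 1 := by
    have : 0 ≤ ∑ i : Fin n, y.1 i.castSucc ^ 2 := Finset.sum_nonneg fun i _ => sq_nonneg _
    have : l ≤ 1 := by nlinarith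
    exact lt_of_le_of_ne this hl1
  let z : Fin n → ℝ := fun i => y.1 i.castSucc / (1 - l)
  let M : ℝ := max 1 ‖z‖
  have hM : 0 < M := lt_of_lt_of_le one_pos (le_max_left _ _)
  let F : ℝ → ℝ := fun s => s - ∏ i, (1 - (s * z i) ^ 2)
  have hF : Continuous F := by fun_prop
  have hF0 : F 0 ≤ 0 := by simp [F]
  have hz : ∀ i, |z i| ≤ M := fun i => (norm_le_pi_norm z i).trans (le_max_right _ _)
  have hb : ∀ s, 0 ≤ s → s ≤ 1 / M → ∀ i, |s * z i| ≤ 1 := by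
    intro s hs hs' i
    rw [abs_mul, abs_of_nonneg hs]
    calc s * |z i| ≤ (1 / M) * M := mul_le_mul hs' (hz i) (abs_nonneg _) (by positivity)
      _ = 1 := by field_simp
  have hF1 : 0 ≤ F (1 / M) := by
    have hnn : ∀ i, 0 ≤ 1 - (1 / M * z i) ^ 2 := fun i => by
      have := hb (1 / M) (by positivity) le_rfl i
      have := (sq_le_one_iff_abs_le_one _).2 this
      linarith
    have hle : ∏ i, (1 - (1 / M * z i) ^ 2) ≤ 1 :=
      Finset.prod_le_one (fun i _ => hnn i) fun i _ => by linarith [sq_nonneg (1 / M * z i)]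
    rcases le_total ‖z‖ 1 with h | h
    · have : M = 1 := max_eq_left h
      simp only [F]
      rw [this] at hle ⊢
      linarith
    · have hMz : M = ‖z‖ := max_eq_right h
      obtain ⟨i, hi⟩ : ∃ i, |z i| = M := by
        have : Nonempty (Fin n) := ⟨⟨0, Nat.pos_of_ne_zero hn⟩⟩
        obtain ⟨i, hi⟩ := Finite.exists_max fun i => |z i|
        refine ⟨i, le_antisymm (hz i) ?_⟩
        rw [hMz]
        exact (pi_norm_le_iff_of_nonneg (abs_nonneg _)).2 hi
      have h0 : ∏ i, (1 - (1 / M * z i) ^ 2) = 0 := by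
        refine Finset.prod_eq_zero (Finset.mem_univ i) ?_
        rw [mul_pow, ← sq_abs (z i), hi]
        field_simp
        ring
      simp only [F]
      rw [h0]
      simp [hM.le]
  obtain ⟨s, ⟨hs0, hs1⟩, hs⟩ : (0 : ℝ) ∈ F '' Set.Icc 0 (1 / M) :=
    intermediate_value_Icc (by positivity) hF.continuousOn ⟨hF0, hF1⟩
  have hspos : s ≠ 0 := by
    rintro rfl
    simp [F] at hs
  have hab := hb s hs0 hs1
  let t : I^ (Fin n) := fun i => ⟨(s * z i + 1) / 2, by
    have := abs_le.1 (hab i)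
    constructor <;> linarith⟩
  have hc : ∀ i, ctr t i = s * z i := fun i => by simp [ctr, t]; ring
  have hwt : wt t = s := by
    have : wt t = ∏ i, (1 - (s * z i) ^ 2) := by simp [wt, hc]
    simp only [F] at hs
    linarith
  have h1l : (1 - l) ≠ 0 := by linarith
  have hq : ∑ i : Fin n, y.1 i.castSucc ^ 2 = (1 - l) * (1 + l) := by
    rw [eq_sub_of_add_eq hn2]; ring
  have hnsq : nsq t = s ^ 2 * ((1 + l) / (1 - l)) := by
    have : nsq t = s ^ 2 / (1 - l) ^ 2 * ∑ i : Fin n, y.1 i.castSucc ^ 2 := by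
      simp only [nsq, hc, z]
      rw [Finset.mul_sum]
      refine Finset.sum_congr rfl fun i _ => ?_
      field_simp
    rw [this, hq]
    field_simp
  have hden : nsq t + wt t ^ 2 = 2 * s ^ 2 / (1 - l) := by
    rw [hnsq, hwt]; field_simp; ring
  refine ⟨t, ?_⟩
  ext i
  refine Fin.lastCases ?_ (fun i => ?_) i
  · rw [cell_last, hden, hnsq, hwt, ← hl]
    field_simp
    ring
  · rw [cell_castSucc, hden, hwt, hc]
    simp only [z]
    field_simp

theorem cell_isQuotientMap (hn : n ≠ 0) : Topology.IsQuotientMap (cell (n := n)) :=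
  cell.continuous.isClosedMap.isQuotientMap cell.continuous (cell_surjective hn)

theorem cell_prod_isQuotientMap (hn : n ≠ 0) :
    Topology.IsQuotientMap ((cell (n := n)).prodMap (cell (n := n))) :=
  (cell.prodMap cell).continuous.isClosedMap.isQuotientMap (cell.prodMap cell).continuous
    ((cell_surjective hn).prodMap (cell_surjective hn))

/-! ### The pinch maps -/

/-- `t ↦ min (2 t) 1`. -/
def lowerTime : C(I, I) where
  toFun t := Set.projIcc 0 1 zero_le_one (2 * (t : ℝ))
  continuous_toFun := by fun_prop

/-- `t ↦ max (2 t - 1) 0`. -/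
def upperTime : C(I, I) where
  toFun t := Set.projIcc 0 1 zero_le_one (2 * (t : ℝ) - 1)
  continuous_toFun := by fun_prop

theorem lowerTime_zero : lowerTime 0 = 0 := by ext; simp [lowerTime]
theorem lowerTime_of_le {t : I} (h : 1 / 2 ≤ (t : ℝ)) : lowerTime t = 1 :=
  Set.projIcc_of_right_le zero_le_one (by linarith)
theorem lowerTime_one : lowerTime 1 = 1 := lowerTime_of_le (by norm_num)
theorem upperTime_of_le {t : I} (h : (t : ℝ) ≤ 1 / 2) : upperTime t = 0 :=
  Set.projIcc_of_le_left zero_le_one (by linarith)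
theorem upperTime_zero : upperTime 0 = 0 := upperTime_of_le (by norm_num)
theorem upperTime_one : upperTime 1 = 1 := Set.projIcc_of_right_le zero_le_one (by norm_num)

/-- Apply `ρ` to the first coordinate of a point of the cube. -/
def firstCoord (hn : n ≠ 0) (ρ : C(I, I)) : C(I^ (Fin n), I^ (Fin n)) where
  toFun t := Function.update t ⟨0, Nat.pos_of_ne_zero hn⟩ (ρ (t ⟨0, Nat.pos_of_ne_zero hn⟩))
  continuous_toFun := by fun_prop

theorem firstCoord_boundary (hn : n ≠ 0) {ρ : C(I, I)} (h0 : ρ 0 = 0) (h1 : ρ 1 = 1)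
    {t : I^ (Fin n)} (ht : t ∈ Cube.boundary (Fin n)) :
    firstCoord hn ρ t ∈ Cube.boundary (Fin n) := by
  obtain ⟨i, hi⟩ := ht
  refine ⟨i, ?_⟩
  by_cases h : i = ⟨0, Nat.pos_of_ne_zero hn⟩
  · subst h
    rcases hi with hi | hi <;> simp [firstCoord, hi, h0, h1]
  · simpa [firstCoord, h] using hi

theorem firstCoord_factorsThrough (hn : n ≠ 0) {ρ : C(I, I)} (h0 : ρ 0 = 0) (h1 : ρ 1 = 1) :
    Function.FactorsThrough (cell.comp (firstCoord hn ρ)) (cell (n := n)) := by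
  intro s t hst
  rcases cell_inj hst with rfl | ⟨hs, ht⟩
  · rfl
  · simp only [ContinuousMap.comp_apply]
    rw [cell_eq_base.2 (firstCoord_boundary hn h0 h1 hs),
      cell_eq_base.2 (firstCoord_boundary hn h0 h1 ht)]

/-- The self-map of `S^n = I^n / ∂I^n` that applies `ρ` to the first coordinate. -/
def stretch (hn : n ≠ 0) (ρ : C(I, I)) (h0 : ρ 0 = 0) (h1 : ρ 1 = 1) : C(Sph n, Sph n) :=
  (cell_isQuotientMap hn).lift (cell.comp (firstCoord hn ρ)) (firstCoord_factorsThrough hn h0 h1)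

theorem stretch_cell (hn : n ≠ 0) (ρ : C(I, I)) (h0 : ρ 0 = 0) (h1 : ρ 1 = 1) (t : I^ (Fin n)) :
    stretch hn ρ h0 h1 (cell t) = cell (firstCoord hn ρ t) :=
  DFunLike.congr_fun ((cell_isQuotientMap hn).lift_comp (cell.comp (firstCoord hn ρ))
    (firstCoord_factorsThrough hn h0 h1)) t

theorem stretch_base (hn : n ≠ 0) (ρ : C(I, I)) (h0 : ρ 0 = 0) (h1 : ρ 1 = 1) :
    stretch hn ρ h0 h1 (base n) = base n := by
  obtain ⟨t, ht⟩ := cell_surjective hn (base n)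
  rw [← ht, stretch_cell, ht, cell_eq_base]
  exact firstCoord_boundary hn h0 h1 (cell_eq_base.1 ht)

/-- The map `S^n → S^n` that stretches the half `t₀ ≤ 1/2` over the whole sphere and collapses the
other half to the base point. -/
def lower (hn : n ≠ 0) : C(Sph n, Sph n) := stretch hn lowerTime lowerTime_zero lowerTime_one

/-- The map `S^n → S^n` that stretches the half `t₀ ≥ 1/2` over the whole sphere and collapses the
other half to the base point. -/
def upper (hn : n ≠ 0) : C(Sph n, Sph n) := stretch hn upperTime upperTime_zero upperTime_one

theorem lower_or_upper (hn : n ≠ 0) (p : Sph n) : lower hn p = base n ∨ upper hn p = base n := by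
  obtain ⟨t, rfl⟩ := cell_surjective hn p
  rcases le_total (t ⟨0, Nat.pos_of_ne_zero hn⟩ : ℝ) (1 / 2) with h | h
  · right
    rw [upper, stretch_cell, cell_eq_base]
    exact ⟨⟨0, Nat.pos_of_ne_zero hn⟩, Or.inl (by simp [firstCoord, upperTime_of_le h])⟩
  · left
    rw [lower, stretch_cell, cell_eq_base]
    exact ⟨⟨0, Nat.pos_of_ne_zero hn⟩, Or.inr (by simp [firstCoord, lowerTime_of_le h])⟩

/-- The H-group operation `α ⋆ β` of `Map*(S^n, A)`, `n ≥ 1`: precomposition of `(α, β)` with the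
pinch map `S^n → S^n ∨ S^n`, i.e. concatenation in the first coordinate of the cube. -/
def mul (hn : n ≠ 0) {A : Type*} [TopologicalSpace A] (a : A) :
    C(PointedMap (Sph n) A (base n) a × PointedMap (Sph n) A (base n) a,
      PointedMap (Sph n) A (base n) a) :=
  Wedge.pull (lower hn) (upper hn) (lower_or_upper hn) (stretch_base hn _ _ _)
    (stretch_base hn _ _ _) a

end Sph

/-- The squared sphere `(S^m)² = S^m × S^m`. -/
abbrev SqSph (m : ℕ) : Type := Sph m × Sph m

namespace SqSph

variable {m : ℕ}

/-- The base point of the squared sphere. -/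
def base (m : ℕ) : SqSph m := (Sph.base m, Sph.base m)

theorem append_boundary {u v : I^ (Fin m)} :
    Fin.append u v ∈ Cube.boundary (Fin (m + m)) ↔
      u ∈ Cube.boundary (Fin m) ∨ v ∈ Cube.boundary (Fin m) := by
  constructor
  · rintro ⟨i, hi⟩
    revert hi
    refine Fin.addCases (fun i hi => ?_) (fun i hi => ?_) i
    · exact Or.inl ⟨i, by simpa using hi⟩
    · exact Or.inr ⟨i, by simpa only [Fin.append_right] using hi⟩
  · rintro (⟨i, hi⟩ | ⟨i, hi⟩)
    · exact ⟨Fin.castAdd m i, by simpa using hi⟩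
    · exact ⟨Fin.natAdd m i, by simpa only [Fin.append_right] using hi⟩

/-- Concatenation of coordinates, `I^m × I^m → I^(m+m)`. -/
def appendCube : C((I^ (Fin m)) × (I^ (Fin m)), I^ (Fin (m + m))) where
  toFun p := Fin.append p.1 p.2
  continuous_toFun := by
    refine continuous_pi fun i => Fin.addCases (fun i => ?_) (fun i => ?_) i
    · simp only [Fin.append_left]; fun_prop
    · simp only [Fin.append_right]; fun_prop

theorem append_factorsThrough :
    Function.FactorsThrough (Sph.cell.comp (appendCube (m := m)))
      (Sph.cell.prodMap (Sph.cell (n := m))) := by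
  rintro ⟨u, v⟩ ⟨u', v'⟩ h
  have h1 : Sph.cell u = Sph.cell u' := congrArg Prod.fst h
  have h2 : Sph.cell v = Sph.cell v' := congrArg Prod.snd h
  have key : Fin.append u v = Fin.append u' v' ∨
      (Fin.append u v ∈ Cube.boundary (Fin (m + m)) ∧
        Fin.append u' v' ∈ Cube.boundary (Fin (m + m))) := by
    simp only [append_boundary]
    rcases Sph.cell_inj h1 with rfl | ⟨a, b⟩
    · rcases Sph.cell_inj h2 with rfl | ⟨a, b⟩
      · exact Or.inl rfl
      · exact Or.inr ⟨Or.inr a, Or.inr b⟩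
    · exact Or.inr ⟨Or.inl a, Or.inl b⟩
  change Sph.cell (Fin.append u v) = Sph.cell (Fin.append u' v')
  rcases key with h | ⟨a, b⟩
  · rw [h]
  · rw [Sph.cell_eq_base.2 a, Sph.cell_eq_base.2 b]

/-- The map `S^m × S^m → S^m ∧ S^m ≅ S^(2m)` that collapses `S^m ∨ S^m` to the base point. -/
def smash (hm : m ≠ 0) : C(SqSph m, Sph (m + m)) :=
  (Sph.cell_prod_isQuotientMap hm).lift (Sph.cell.comp appendCube) append_factorsThrough

theorem smash_cell (hm : m ≠ 0) (u v : I^ (Fin m)) :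
    smash hm (Sph.cell u, Sph.cell v) = Sph.cell (Fin.append u v) :=
  DFunLike.congr_fun ((Sph.cell_prod_isQuotientMap hm).lift_comp (Sph.cell.comp appendCube)
    append_factorsThrough) (u, v)

theorem smash_eq_base (hm : m ≠ 0) {p q : Sph m} (h : p = Sph.base m ∨ q = Sph.base m) :
    smash hm (p, q) = Sph.base (m + m) := by
  obtain ⟨u, rfl⟩ := Sph.cell_surjective hm p
  obtain ⟨v, rfl⟩ := Sph.cell_surjective hm q
  rw [smash_cell, Sph.cell_eq_base, append_boundary]
  exact h.imp Sph.cell_eq_base.1 Sph.cell_eq_base.1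

/-- The first component of the pinch map, a self-map of the squared sphere. -/
def outer (hm : m ≠ 0) : C(SqSph m, SqSph m) := (Sph.upper hm).prodMap (Sph.upper hm)

/-- The second component of the pinch map. It collapses the complement of the ball
`{u₀ ≤ 1/2, v₀ ≤ 1/2}` in the top cell of the squared sphere. -/
def inner (hm : m ≠ 0) : C(SqSph m, Sph (m + m)) :=
  (smash hm).comp ((Sph.lower hm).prodMap (Sph.lower hm))

theorem outer_or_inner (hm : m ≠ 0) (p : SqSph m) :
    outer hm p = base m ∨ inner hm p = Sph.base (m + m) := by
  rcases Sph.lower_or_upper hm p.1 with h | h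
  · exact Or.inr (smash_eq_base hm (Or.inl h))
  rcases Sph.lower_or_upper hm p.2 with h' | h'
  · exact Or.inr (smash_eq_base hm (Or.inr h'))
  · exact Or.inl (Prod.ext h h')

theorem outer_base (hm : m ≠ 0) : outer hm (base m) = base m :=
  Prod.ext (Sph.stretch_base hm _ _ _) (Sph.stretch_base hm _ _ _)

theorem inner_base (hm : m ≠ 0) : inner hm (base m) = Sph.base (m + m) :=
  smash_eq_base hm (Or.inl (Sph.stretch_base hm _ _ _))

/-- The pinch map `(S^m)² → (S^m)² ∨ S^(2m)`. In the coordinates `(u, v) ∈ I^m × I^m` of the top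
cell of the squared sphere, it collapses the boundary of the ball `D = {u₀ ≤ 1/2, v₀ ≤ 1/2}` to the
wedge point, is the homeomorphism `D / ∂D ≅ S^(2m)` given by doubling `u₀` and `v₀` on `D`, and
sends the complement of `D` to the summand `(S^m)²` by `u₀ ↦ max (2 u₀ - 1) 0`,
`v₀ ↦ max (2 v₀ - 1) 0`. -/
def pinch (hm : m ≠ 0) : C(SqSph m, Wedge (SqSph m) (Sph (m + m)) (base m) (Sph.base (m + m))) :=
  Wedge.lift (outer hm) (inner hm) (outer_or_inner hm)

/-- The pinch action `Θ : Map*(S^(2m), A) × Map*((S^m)², A) → Map*((S^m)², A)`, sending `(α, f)` to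
the composite of the pinch map `(S^m)² → (S^m)² ∨ S^(2m)` with `(f, α)`. -/
def pinchAction (hm : m ≠ 0) {A : Type*} [TopologicalSpace A] (a : A) :
    C(PointedMap (Sph (m + m)) A (Sph.base (m + m)) a × PointedMap (SqSph m) A (base m) a,
      PointedMap (SqSph m) A (base m) a) :=
  (Wedge.pull (outer hm) (inner hm) (outer_or_inner hm) (outer_base hm) (inner_base hm) a).comp
    ContinuousMap.prodSwap

theorem pinchAction_coe (hm : m ≠ 0) {A : Type*} [TopologicalSpace A] (a : A)
    (α : PointedMap (Sph (m + m)) A (Sph.base (m + m)) a) (f : PointedMap (SqSph m) A (base m) a) :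
    (pinchAction hm a (α, f)).1 = (Wedge.desc f α).1.comp (pinch hm) := rfl

end SqSph

/-! ### The mapping spaces into even spheres -/

theorem odd_ne_zero {k : ℕ} (hk : 1 ≤ k) : 2 * k - 1 ≠ 0 := by omega

/-- `Map*((S^(2k-1))², S^(2k))`. -/
abbrev SqSphMaps (k : ℕ) : Type :=
  PointedMap (SqSph (2 * k - 1)) (Sph (2 * k)) (SqSph.base _) (Sph.base _)

/-- `Map*(S^(4k-2), S^(2k))`, where `4k - 2 = (2k - 1) + (2k - 1)`. -/
abbrev SphMaps (k : ℕ) : Type :=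
  PointedMap (Sph ((2 * k - 1) + (2 * k - 1))) (Sph (2 * k)) (Sph.base _) (Sph.base _)

/-- The H-group operation of `Map*(S^(4k-2), S^(2k))`. -/
def sphMul {k : ℕ} (hk : 1 ≤ k) : C(SphMaps k × SphMaps k, SphMaps k) :=
  Sph.mul (by omega) (Sph.base (2 * k))

/-- The pinch action `Θ` of `Map*(S^(4k-2), S^(2k))` on `Map*((S^(2k-1))², S^(2k))`. -/
def theta {k : ℕ} (hk : 1 ≤ k) : C(SphMaps k × SqSphMaps k, SqSphMaps k) :=
  SqSph.pinchAction (odd_ne_zero hk) (Sph.base (2 * k))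

end

/-! The pinch action can be computed on values: `Θ(α, f)` at a point is `f` of one self-map or `α`
of another, and at most one of the two differs from the base point. In this form both sides of the
action law place `α`, `β` and `f` on three regions of the cube `I^m × I^m`. The two subdivisions are
joined by a family in which the regions stay disjoint up to their boundaries, and this family is the
homotopy (`SqSph.assocHomotopy`, `SqSph.pinchAction_mul`). If `α` is constant, only precomposition
with `SqSph.outer` remains. It is homotopic to the identity, since endpoint-preserving self-maps of
`I` can be joined linearly (`SqSph.pinchAction_const`).

Reversing the first coordinate gives inverses in the H-group (`Sph.mul_inv`), so the action law
makes `Θ(α, -)` and `Θ(α⁻¹, -)` inverse to each other up to homotopy.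

For the components it suffices to join every `f` by a path to some `Θ(α, const)`. The restrictions
of `f` to the two axes are nullhomotopic because `2k - 1 < 2k` (`Sph.homotopicRel_const`: a map that
is smooth on the cube misses a direction). These nullhomotopies extend to a homotopy of `f`
(`SqSph.exists_homotopicRel_const_wedge`), which makes `f` constant on `S^m ∨ S^m`. The result
factors through `S^m ∧ S^m = S^(2m)`, and the factor is the required `α`. If `α` leads from the
constant map to `f` and `β` leads to `g`, then `β ⋆ α⁻¹` leads from `f` to `g`, and the homotopy
equivalence restricts to the components. -/

noncomputable section

/-! ### Gluing maps of which at most one is nontrivial at each point -/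

open Classical in
/-- The first of two points of `A` that is not `a`, if there is one. -/
def join {A : Type*} (a x y : A) : A := if x = a then y else x

section join

variable {A W : Type*} {a x y : A}

theorem join_of_left (h : x = a) : join a x y = y := if_pos h

theorem join_of_right (h : y = a) : join a x y = x := by
  by_cases hx : x = a
  · rw [join_of_left hx, h, hx]
  · exact if_neg hx

/-- Both sides select the first of three values that is not `a`, so no disjointness is needed. This
does the rebracketing in the action law. -/
theorem join_assoc (a x y z : A) : join a (join a x y) z = join a x (join a y z) := by
  by_cases hx : x = a
  · rw [join_of_left hx, join_of_left hx]
  · simp [join, hx]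

/-- As points of `A` are closed, the two sets on which one of the maps is trivial form a closed
cover, and on each of them the join is the other map. -/
theorem Continuous.join [TopologicalSpace A] [T1Space A] [TopologicalSpace W] {F G : W → A}
    (hF : Continuous F) (hG : Continuous G) (h : ∀ w, F w = a ∨ G w = a) :
    Continuous fun w => join a (F w) (G w) := by
  rw [← continuousOn_univ, show (Set.univ : Set W) = {w | F w = a} ∪ {w | G w = a} from
    (Set.eq_univ_of_forall h).symm]
  refine ContinuousOn.union_of_isClosed (hG.continuousOn.congr fun w hw => ?_)
    (hF.continuousOn.congr fun w hw => ?_) (isClosed_singleton.preimage hF)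
    (isClosed_singleton.preimage hG)
  · exact join_of_left hw
  · exact join_of_right hw

end join

/-- Eliminates the wedge: from here on, the action and the H-group operation are handled only
through their values. -/
theorem Wedge.pull_apply {X Y Z A : Type*} [TopologicalSpace X] [TopologicalSpace Y]
    [TopologicalSpace Z] [TopologicalSpace A] {x : X} {y : Y} {z : Z} [T1Space X] [T1Space Y]
    [LocallyCompactSpace X] [LocallyCompactSpace Y] (f : C(Z, X)) (g : C(Z, Y))
    (h : ∀ p, f p = x ∨ g p = y) (hf : f z = x) (hg : g z = y) (a : A)
    (w : PointedMap X A x a × PointedMap Y A y a) (p : Z) :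
    (Wedge.pull f g h hf hg a w).1 p = join a (w.1.1 (f p)) (w.2.1 (g p)) := by
  change (Wedge.desc w.1 w.2).1 (Wedge.lift f g h p) = _
  by_cases hp : g p = y
  · rw [Wedge.lift_of_right f g h hp, Wedge.desc_inl, join_of_right (by rw [hp, w.2.2])]
  · have hq := (h p).resolve_right hp
    rw [Wedge.lift_of_left f g h hq, Wedge.desc_inr, join_of_left (by rw [hq, w.1.2])]

/-! ### Paths and homotopies in pointed mapping spaces -/

namespace PointedMap

variable {X Y Z A : Type*} [TopologicalSpace X] [TopologicalSpace Y] [TopologicalSpace Z]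
  [TopologicalSpace A] {x : X} {y : Y} {z : Z} {a : A}

/-- A pointed homotopy of pointed maps, as a path in the pointed mapping space. -/
theorem joined_of_homotopicRel {f g : PointedMap X A x a} (h : f.1.HomotopicRel g.1 {x}) :
    Joined f g := by
  obtain ⟨H⟩ := h
  refine ⟨⟨⟨fun t => ⟨H.toHomotopy.curry t, ?_⟩, ?_⟩, ?_, ?_⟩⟩
  · exact (H.eq_fst t rfl).trans f.2
  · exact H.toHomotopy.curry.continuous.subtype_mk _
  · ext p; simp
  · ext p; simp

/-- Precomposition with a pointed map. -/
def precomp (φ : C(Z, X)) (hφ : φ z = x) (a : A) : C(PointedMap X A x a, PointedMap Z A z a) where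
  toFun f := ⟨f.1.comp φ, by rw [ContinuousMap.comp_apply, hφ, f.2]⟩
  continuous_toFun := by fun_prop

/-- A homotopy curries to a path of maps, and composition is jointly continuous because the middle
space `X` is locally compact. The constant map absorbs every precomposition, hence the relative
form. -/
theorem precomp_homotopicRel {φ ψ : C(Z, X)} (hφ : φ z = x) (hψ : ψ z = x)
    [LocallyCompactSpace X] (h : φ.HomotopicRel ψ {z}) (a : A) :
    (precomp φ hφ a).HomotopicRel (precomp ψ hψ a) {const x a} := by
  obtain ⟨H⟩ := h
  refine ⟨⟨⟨⟨fun w => ⟨w.2.1.comp (H.toHomotopy.curry w.1), ?_⟩, ?_⟩, ?_, ?_⟩, ?_⟩⟩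
  · change w.2.1 (H (w.1, z)) = a
    rw [H.eq_fst w.1 rfl, hφ, w.2.2]
  · exact ((continuous_subtype_val.comp continuous_snd).compCM
      (H.toHomotopy.curry.continuous.comp continuous_fst)).subtype_mk _
  · intro f; ext p; simp [precomp]
  · intro f; ext p; simp [precomp]
  · rintro t f rfl; rfl

end PointedMap

/-! ### Reparametrising the first coordinate of a sphere -/

namespace Sph

variable {n : ℕ}

/-- A continuous surjection from a compact to a Hausdorff space is a quotient map. With a parameter
space `T` in the product, whole homotopies descend from the cube to the sphere. -/
theorem id_prod_cell_isQuotientMap (hn : n ≠ 0) (T : Type*) [TopologicalSpace T] [CompactSpace T]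
    [T2Space T] : Topology.IsQuotientMap ((ContinuousMap.id T).prodMap (cell (n := n))) :=
  ((ContinuousMap.id T).prodMap cell).continuous.isClosedMap.isQuotientMap
    ((ContinuousMap.id T).prodMap cell).continuous
    (Function.surjective_id.prodMap (cell_surjective hn))

section family

variable {T : Type*} [TopologicalSpace T]

/-- A family of reparametrisations of the first coordinate of the cube. -/
def firstCoordFamily (hn : n ≠ 0) (ρ : C(T × I, I)) : C(T × (I^ (Fin n)), I^ (Fin n)) where
  toFun p := Function.update p.2 ⟨0, Nat.pos_of_ne_zero hn⟩
    (ρ (p.1, p.2 ⟨0, Nat.pos_of_ne_zero hn⟩))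
  continuous_toFun := by fun_prop

/-- Endpoints only have to go to endpoints, not to themselves. This admits the reversal, which swaps
them, and the folding homotopy, which sends both to 0. -/
theorem firstCoordFamily_boundary (hn : n ≠ 0) {ρ : C(T × I, I)}
    (h0 : ∀ τ, ρ (τ, 0) = 0 ∨ ρ (τ, 0) = 1) (h1 : ∀ τ, ρ (τ, 1) = 0 ∨ ρ (τ, 1) = 1) (τ : T)
    {t : I^ (Fin n)} (ht : t ∈ Cube.boundary (Fin n)) :
    firstCoordFamily hn ρ (τ, t) ∈ Cube.boundary (Fin n) := by
  obtain ⟨i, hi⟩ := ht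
  refine ⟨i, ?_⟩
  by_cases h : i = ⟨0, Nat.pos_of_ne_zero hn⟩
  · subst h
    rcases hi with hi | hi
    · simpa [firstCoordFamily, hi] using h0 τ
    · simpa [firstCoordFamily, hi] using h1 τ
  · simpa [firstCoordFamily, h] using hi

theorem firstCoordFamily_factorsThrough (hn : n ≠ 0) {ρ : C(T × I, I)}
    (h0 : ∀ τ, ρ (τ, 0) = 0 ∨ ρ (τ, 0) = 1) (h1 : ∀ τ, ρ (τ, 1) = 0 ∨ ρ (τ, 1) = 1) :
    Function.FactorsThrough (cell.comp (firstCoordFamily hn ρ))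
      ((ContinuousMap.id T).prodMap (cell (n := n))) := by
  rintro ⟨κ, s⟩ ⟨τ, t⟩ hst
  obtain rfl : κ = τ := congrArg Prod.fst hst
  rcases cell_inj (congrArg Prod.snd hst : cell s = cell t) with rfl | ⟨hs, ht⟩
  · rfl
  · simp only [ContinuousMap.comp_apply]
    rw [cell_eq_base.2 (firstCoordFamily_boundary hn h0 h1 _ hs),
      cell_eq_base.2 (firstCoordFamily_boundary hn h0 h1 _ ht)]

variable [CompactSpace T] [T2Space T]

/-- The family of self-maps of `S^n = I^n / ∂I^n` that applies `ρ τ` to the first coordinate. -/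
def stretchFamily (hn : n ≠ 0) (ρ : C(T × I, I)) (h0 : ∀ τ, ρ (τ, 0) = 0 ∨ ρ (τ, 0) = 1)
    (h1 : ∀ τ, ρ (τ, 1) = 0 ∨ ρ (τ, 1) = 1) : C(T × Sph n, Sph n) :=
  (id_prod_cell_isQuotientMap hn T).lift (cell.comp (firstCoordFamily hn ρ))
    (firstCoordFamily_factorsThrough hn h0 h1)

variable (hn : n ≠ 0) (ρ : C(T × I, I)) (h0 : ∀ τ, ρ (τ, 0) = 0 ∨ ρ (τ, 0) = 1)
  (h1 : ∀ τ, ρ (τ, 1) = 0 ∨ ρ (τ, 1) = 1)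

theorem stretchFamily_cell (τ : T) (t : I^ (Fin n)) :
    stretchFamily hn ρ h0 h1 (τ, cell t) = cell (Function.update t ⟨0, Nat.pos_of_ne_zero hn⟩
      (ρ (τ, t ⟨0, Nat.pos_of_ne_zero hn⟩))) :=
  DFunLike.congr_fun ((id_prod_cell_isQuotientMap hn T).lift_comp
    (cell.comp (firstCoordFamily hn ρ)) (firstCoordFamily_factorsThrough hn h0 h1)) (τ, t)

theorem stretchFamily_base (τ : T) : stretchFamily hn ρ h0 h1 (τ, base n) = base n := by
  obtain ⟨t, ht⟩ := cell_surjective hn (base n)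
  rw [← ht, stretchFamily_cell, ht, cell_eq_base]
  exact firstCoordFamily_boundary hn h0 h1 τ (cell_eq_base.1 ht)

theorem stretchFamily_cell_eq_base {τ : T} {t : I^ (Fin n)}
    (h : ρ (τ, t ⟨0, Nat.pos_of_ne_zero hn⟩) = 0 ∨ ρ (τ, t ⟨0, Nat.pos_of_ne_zero hn⟩) = 1) :
    stretchFamily hn ρ h0 h1 (τ, cell t) = base n := by
  rw [stretchFamily_cell, cell_eq_base]
  exact ⟨⟨0, Nat.pos_of_ne_zero hn⟩, by simpa using h⟩

theorem stretchFamily_eq_stretch {τ : T} (κ : C(I, I)) (g0 : κ 0 = 0) (g1 : κ 1 = 1)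
    (h : ∀ t, ρ (τ, t) = κ t) (x : Sph n) :
    stretchFamily hn ρ h0 h1 (τ, x) = stretch hn κ g0 g1 x := by
  obtain ⟨t, rfl⟩ := cell_surjective hn x
  rw [stretchFamily_cell, stretch_cell, h]; rfl

end family

theorem stretch_stretch (hn : n ≠ 0) (ρ κ : C(I, I)) (h0 : ρ 0 = 0) (h1 : ρ 1 = 1) (g0 : κ 0 = 0)
    (g1 : κ 1 = 1) (x : Sph n) : stretch hn ρ h0 h1 (stretch hn κ g0 g1 x) =
      stretch hn (ρ.comp κ) (by simp [g0, h0]) (by simp [g1, h1]) x := by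
  obtain ⟨t, rfl⟩ := cell_surjective hn x
  simp [stretch_cell, firstCoord]

theorem stretch_id (hn : n ≠ 0) (x : Sph n) :
    stretch hn (ContinuousMap.id I) (ContinuousMap.id_apply 0) (ContinuousMap.id_apply 1) x = x := by
  obtain ⟨t, rfl⟩ := cell_surjective hn x
  rw [stretch_cell]
  simp [firstCoord]

/-- The linear homotopy between two self-maps of the interval. -/
def _root_.unitInterval.lineMap (ρ κ : C(I, I)) : C(I × I, I) where
  toFun p := ⟨(1 - p.1) * (ρ p.2 : ℝ) + p.1 * (κ p.2 : ℝ), by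
    have := convex_Icc (0 : ℝ) 1 (ρ p.2).2 (κ p.2).2 (sub_nonneg.2 p.1.2.2) p.1.2.1 (by ring)
    simpa using this⟩
  continuous_toFun := by fun_prop

/-- The linear homotopy between the two reparametrisations keeps 0 and 1 fixed at all times, so it
descends to the sphere and fixes the base point. -/
theorem stretch_homotopicRel (hn : n ≠ 0) (ρ κ : C(I, I)) (h0 : ρ 0 = 0) (h1 : ρ 1 = 1)
    (g0 : κ 0 = 0) (g1 : κ 1 = 1) :
    (stretch hn ρ h0 h1).HomotopicRel (stretch hn κ g0 g1) {base n} := by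
  have k0 : ∀ τ, unitInterval.lineMap ρ κ (τ, 0) = 0 := fun τ => by
    ext; simp [unitInterval.lineMap, h0, g0]
  have k1 : ∀ τ, unitInterval.lineMap ρ κ (τ, 1) = 1 := fun τ => by
    ext; simp [unitInterval.lineMap, h1, g1]
  refine ⟨⟨⟨stretchFamily hn (unitInterval.lineMap ρ κ) (fun τ => Or.inl (k0 τ))
    (fun τ => Or.inr (k1 τ)), fun x => ?_, fun x => ?_⟩, ?_⟩⟩
  · exact stretchFamily_eq_stretch hn _ _ _ ρ h0 h1 (fun t => by
      ext; simp [unitInterval.lineMap]) x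
  · exact stretchFamily_eq_stretch hn _ _ _ κ g0 g1 (fun t => by
      ext; simp [unitInterval.lineMap]) x
  · rintro τ _ rfl
    exact (stretchFamily_base hn _ (fun τ => Or.inl (k0 τ)) (fun τ => Or.inr (k1 τ)) τ).trans
      (stretch_base hn ρ h0 h1).symm

theorem stretch_homotopicRel_id (hn : n ≠ 0) (ρ : C(I, I)) (h0 : ρ 0 = 0) (h1 : ρ 1 = 1) :
    (stretch hn ρ h0 h1).HomotopicRel (ContinuousMap.id _) {base n} := by
  have : stretch hn (ContinuousMap.id I) (ContinuousMap.id_apply 0) (ContinuousMap.id_apply 1) =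
      ContinuousMap.id (Sph n) :=
    ContinuousMap.ext (stretch_id hn)
  exact this ▸ stretch_homotopicRel hn ρ _ h0 h1 _ _

end Sph

/-- Products of pointed homotopies. -/
theorem ContinuousMap.HomotopicRel.prodMap_singleton {X Y X' Y' : Type*} [TopologicalSpace X]
    [TopologicalSpace Y] [TopologicalSpace X'] [TopologicalSpace Y'] {x : X} {y : Y}
    {f g : C(X, X')} {f' g' : C(Y, Y')} (h : f.HomotopicRel g {x}) (h' : f'.HomotopicRel g' {y}) :
    (f.prodMap f').HomotopicRel (g.prodMap g') {(x, y)} := by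
  obtain ⟨H⟩ := h
  obtain ⟨H'⟩ := h'
  refine ⟨⟨⟨⟨fun w => (H (w.1, w.2.1), H' (w.1, w.2.2)), by fun_prop⟩, ?_, ?_⟩, ?_⟩⟩
  · intro p; simp [Prod.map]
  · intro p; simp [Prod.map]
  · rintro t _ rfl
    exact Prod.ext (H.eq_fst t rfl) (H'.eq_fst t rfl)

theorem join_comm_of_or {A : Type*} {a x y : A} (h : x = a ∨ y = a) : join a x y = join a y x := by
  rcases h with h | h
  · rw [join_of_left h, join_of_right h]
  · rw [join_of_left h, join_of_right h]

/-! ### Piecewise linear time changes -/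

namespace unitInterval

/-- For each `τ`, the map `I → I` that stretches `[a τ, a τ + w τ]` linearly over `I`. -/
def ramp (a w : C(I, ℝ)) (hw : ∀ τ, 0 < w τ) : C(I × I, I) where
  toFun p := Set.projIcc 0 1 zero_le_one (((p.2 : ℝ) - a p.1) / w p.1)
  continuous_toFun := continuous_projIcc.comp <|
    Continuous.div (by fun_prop) (by fun_prop) fun p => (hw p.1).ne'

variable {a w : C(I, ℝ)} (hw : ∀ τ, 0 < w τ) {τ t : I}

theorem ramp_eq_zero (h : (t : ℝ) ≤ a τ) : ramp a w hw (τ, t) = 0 :=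
  Set.projIcc_of_le_left zero_le_one
    (div_nonpos_of_nonpos_of_nonneg (sub_nonpos.2 h) (hw τ).le)

theorem ramp_eq_one (h : a τ + w τ ≤ t) : ramp a w hw (τ, t) = 1 :=
  Set.projIcc_of_right_le zero_le_one ((one_le_div (hw τ)).2 (by linarith))

theorem ramp_zero (ha : ∀ τ, 0 ≤ a τ) (τ : I) : ramp a w hw (τ, 0) = 0 :=
  ramp_eq_zero hw (by simpa using ha τ)

theorem ramp_one (h : ∀ τ, a τ + w τ ≤ 1) (τ : I) : ramp a w hw (τ, 1) = 1 :=
  ramp_eq_one hw (by simpa using h τ)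

theorem lowerTime_coe (t : I) : (Sph.lowerTime t : ℝ) = max 0 (min 1 (2 * (t : ℝ))) := rfl

theorem upperTime_coe (t : I) : (Sph.upperTime t : ℝ) = max 0 (min 1 (2 * (t : ℝ) - 1)) := rfl

theorem ramp_coe (τ t : I) :
    (ramp a w hw (τ, t) : ℝ) = max 0 (min 1 (((t : ℝ) - a τ) / w τ)) := rfl

/-- The inner clamp acts only where the outer one is already saturated. With the next lemma, this
turns composites of `lowerTime` and `upperTime` into single ramps. -/
theorem max_min_two_mul (x : ℝ) : max 0 (min 1 (2 * max 0 (min 1 x))) = max 0 (min 1 (2 * x)) := by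
  grind

theorem max_min_two_mul_sub (x : ℝ) :
    max 0 (min 1 (2 * max 0 (min 1 x) - 1)) = max 0 (min 1 (2 * x - 1)) := by
  grind

end unitInterval

open unitInterval

/-! ### The unit and action laws up to homotopy -/

namespace SqSph

variable {m : ℕ} {A : Type*} [TopologicalSpace A] {a : A}

theorem pinchAction_apply (hm : m ≠ 0)
    (α : PointedMap (Sph (m + m)) A (Sph.base (m + m)) a) (f : PointedMap (SqSph m) A (base m) a)
    (p : SqSph m) :
    (pinchAction hm a (α, f)).1 p = join a (f.1 (outer hm p)) (α.1 (inner hm p)) :=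
  Wedge.pull_apply _ _ _ (outer_base hm) (inner_base hm) _ _ _

/-- The order with `α` first makes the brackets of the two sides of the action law match those of
`assocHomotopy`. -/
theorem pinchAction_apply' (hm : m ≠ 0)
    (α : PointedMap (Sph (m + m)) A (Sph.base (m + m)) a) (f : PointedMap (SqSph m) A (base m) a)
    (p : SqSph m) :
    (pinchAction hm a (α, f)).1 p = join a (α.1 (inner hm p)) (f.1 (outer hm p)) := by
  rw [pinchAction_apply, join_comm_of_or]
  exact (outer_or_inner hm p).imp (fun h => by rw [h, f.2]) fun h => by rw [h, α.2]

theorem mul_apply {n : ℕ} (hn : n ≠ 0) (α β : PointedMap (Sph n) A (Sph.base n) a) (p : Sph n) :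
    (Sph.mul hn a (α, β)).1 p = join a (α.1 (Sph.lower hn p)) (β.1 (Sph.upper hn p)) :=
  Wedge.pull_apply _ _ _ _ _ _ _ _

/-- The constant map acts on `Map*((S^m)², A)` as the identity, up to pointed homotopy. -/
theorem pinchAction_const (hm : m ≠ 0) (a : A) :
    ((pinchAction hm a).comp ((ContinuousMap.const (PointedMap (SqSph m) A (base m) a)
      (PointedMap.const _ _)).prodMk (ContinuousMap.id _))).HomotopicRel
      (ContinuousMap.id (PointedMap (SqSph m) A (base m) a)) {PointedMap.const _ _} := by
  have h : (outer hm).HomotopicRel (ContinuousMap.id _) {base m} :=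
    (Sph.stretch_homotopicRel_id hm _ _ _).prodMap_singleton
      (Sph.stretch_homotopicRel_id hm _ _ _)
  convert PointedMap.precomp_homotopicRel (outer_base hm) (ContinuousMap.id_apply _) h a using 1
  · ext f p
    exact (pinchAction_apply hm _ f p).trans (join_of_right rfl)
  · rfl

/-- The first coordinate of `I^(m+m)` is the first coordinate of the left factor `I^m`.
Concatenation on `S^(2m)` therefore subdivides the box `D` in the direction `u₀` alone. -/
theorem stretch_smash (hm : m ≠ 0) (hn : m + m ≠ 0) (ρ : C(I, I)) (h0 : ρ 0 = 0) (h1 : ρ 1 = 1)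
    (x y : Sph m) :
    Sph.stretch hn ρ h0 h1 (smash hm (x, y)) = smash hm (Sph.stretch hm ρ h0 h1 x, y) := by
  obtain ⟨u, rfl⟩ := Sph.cell_surjective hm x
  obtain ⟨v, rfl⟩ := Sph.cell_surjective hm y
  rw [smash_cell, Sph.stretch_cell, Sph.stretch_cell, smash_cell]
  congr 1
  have e : (⟨0, Nat.pos_of_ne_zero hn⟩ : Fin (m + m)) =
      Fin.castAdd m ⟨0, Nat.pos_of_ne_zero hm⟩ := rfl
  change Function.update _ _ _ = Fin.append (Function.update _ _ _) _
  ext i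
  refine Fin.addCases (fun i => ?_) (fun i => ?_) i
  · rw [e]
    by_cases h : i = ⟨0, Nat.pos_of_ne_zero hm⟩
    · subst h; rw [Function.update_self, Fin.append_left, Fin.append_left, Function.update_self]
    · have h' : Fin.castAdd m i ≠ Fin.castAdd m ⟨0, Nat.pos_of_ne_zero hm⟩ :=
        fun h'' => h (Fin.castAdd_injective m m h'')
      rw [Function.update_of_ne h', Fin.append_left, Fin.append_left, Function.update_of_ne h]
  · have h' : Fin.natAdd m i ≠ (⟨0, Nat.pos_of_ne_zero hn⟩ : Fin (m + m)) := by
      intro h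
      have := congrArg Fin.val h
      rw [Fin.val_natAdd] at this
      exact hm (Nat.eq_zero_of_add_eq_zero_right this)
    rw [Function.update_of_ne h', Fin.append_right, Fin.append_right]

/-- For each `τ`, the self-map of `S^m` that stretches the part `a τ ≤ t₀ ≤ a τ + w τ` over the whole
sphere. -/
def rampMap (hm : m ≠ 0) (a w : C(I, ℝ)) (hw : ∀ τ, 0 < w τ) (ha : ∀ τ, 0 ≤ a τ)
    (h : ∀ τ, a τ + w τ ≤ 1) : C(I × Sph m, Sph m) :=
  Sph.stretchFamily hm (ramp a w hw) (fun τ => Or.inl (ramp_zero hw ha τ))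
    (fun τ => Or.inr (ramp_one hw h τ))

section ramp

variable (hm : m ≠ 0) {b w : C(I, ℝ)} (hw : ∀ τ, 0 < w τ) (ha : ∀ τ, 0 ≤ b τ)
    (h : ∀ τ, b τ + w τ ≤ 1) {τ : I} {t : I^ (Fin m)}

theorem rampMap_eq_base_of_le (ht : (t ⟨0, Nat.pos_of_ne_zero hm⟩ : ℝ) ≤ b τ) :
    rampMap hm b w hw ha h (τ, Sph.cell t) = Sph.base m :=
  Sph.stretchFamily_cell_eq_base hm _ _ _ (Or.inl (ramp_eq_zero hw ht))

theorem rampMap_eq_base_of_ge (ht : b τ + w τ ≤ (t ⟨0, Nat.pos_of_ne_zero hm⟩ : ℝ)) :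
    rampMap hm b w hw ha h (τ, Sph.cell t) = Sph.base m :=
  Sph.stretchFamily_cell_eq_base hm _ _ _ (Or.inr (ramp_eq_one hw ht))

theorem rampMap_base (τ : I) : rampMap hm b w hw ha h (τ, Sph.base m) = Sph.base m :=
  Sph.stretchFamily_base hm _ _ _ τ

theorem rampMap_eq_stretch (κ : C(I, I)) (h0 : κ 0 = 0) (h1 : κ 1 = 1)
    (hκ : ∀ t : I, (ramp b w hw (τ, t) : ℝ) = κ t) (x : Sph m) :
    rampMap hm b w hw ha h (τ, x) = Sph.stretch hm κ h0 h1 x :=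
  Sph.stretchFamily_eq_stretch hm _ _ _ κ h0 h1 (fun t => Subtype.ext (hκ t)) x

end ramp

/-- The boxes of the homotopy between the two sides of the action law. At the time `τ` the first is
`[0, (1 + τ) / 4] × [0, 1/2]`. -/
def boxOneU (hm : m ≠ 0) : C(I × Sph m, Sph m) :=
  rampMap hm ⟨fun _ => 0, by fun_prop⟩ ⟨fun τ => (1 + τ) / 4, by fun_prop⟩
    (fun τ => by have := τ.2.1; change (0 : ℝ) < (1 + τ) / 4; linarith) (fun _ => le_rfl)
    (fun τ => by have := τ.2.2; change (0 : ℝ) + (1 + τ) / 4 ≤ 1; linarith)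

/-- The second factor of the first box. -/
def boxOneV (hm : m ≠ 0) : C(I × Sph m, Sph m) :=
  rampMap hm ⟨fun _ => 0, by fun_prop⟩ ⟨fun _ => 1 / 2, by fun_prop⟩
    (fun _ => one_half_pos) (fun _ => le_rfl)
    (fun _ => by change (0 : ℝ) + 1 / 2 ≤ 1; norm_num)

/-- The second box is `[(1 + τ) / 4, (2 + τ) / 4] × [τ / 2, (2 + τ) / 4]`. -/
def boxTwoU (hm : m ≠ 0) : C(I × Sph m, Sph m) :=
  rampMap hm ⟨fun τ => (1 + τ) / 4, by fun_prop⟩ ⟨fun _ => 1 / 4, by fun_prop⟩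
    (fun _ => by change (0 : ℝ) < 1 / 4; norm_num)
    (fun τ => by have := τ.2.1; change (0 : ℝ) ≤ (1 + τ) / 4; linarith)
    (fun τ => by have := τ.2.2; change ((1 + τ) / 4 + 1 / 4 : ℝ) ≤ 1; linarith)

/-- The second factor of the second box. -/
def boxTwoV (hm : m ≠ 0) : C(I × Sph m, Sph m) :=
  rampMap hm ⟨fun τ => τ / 2, by fun_prop⟩ ⟨fun τ => 1 / 2 - τ / 4, by fun_prop⟩
    (fun τ => by have := τ.2.2; change (0 : ℝ) < 1 / 2 - τ / 4; linarith)
    (fun τ => by have := τ.2.1; change (0 : ℝ) ≤ τ / 2; linarith)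
    (fun τ => by have := τ.2.2; change (τ / 2 + (1 / 2 - τ / 4) : ℝ) ≤ 1; linarith)

/-- Both factors of the complement of the box `[0, (2 + τ) / 4]²` that contains the first two. -/
def boxThree (hm : m ≠ 0) : C(I × Sph m, Sph m) :=
  rampMap hm ⟨fun τ => (2 + τ) / 4, by fun_prop⟩ ⟨fun τ => (2 - τ) / 4, by fun_prop⟩
    (fun τ => by have := τ.2.2; change (0 : ℝ) < (2 - τ) / 4; linarith)
    (fun τ => by have := τ.2.1; change (0 : ℝ) ≤ (2 + τ) / 4; linarith)
    (fun τ => by change ((2 + τ) / 4 + (2 - τ) / 4 : ℝ) ≤ 1; linarith)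

/-- The first component of the homotopy of pinch maps. -/
def assocOne (hm : m ≠ 0) : C(I × SqSph m, Sph (m + m)) :=
  (smash hm).comp ⟨fun w => (boxOneU hm (w.1, w.2.1), boxOneV hm (w.1, w.2.2)), by fun_prop⟩

/-- The second component of the homotopy of pinch maps. -/
def assocTwo (hm : m ≠ 0) : C(I × SqSph m, Sph (m + m)) :=
  (smash hm).comp ⟨fun w => (boxTwoU hm (w.1, w.2.1), boxTwoV hm (w.1, w.2.2)), by fun_prop⟩

/-- The third component of the homotopy of pinch maps. -/
def assocThree (hm : m ≠ 0) : C(I × SqSph m, SqSph m) :=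
  ⟨fun w => (boxThree hm (w.1, w.2.1), boxThree hm (w.1, w.2.2)), by fun_prop⟩

/-- The first two boxes are separated by `u₀ = (1 + τ) / 4`, and the first lies in the square `[0,
(2 + τ) / 4]²` that the third map collapses. Together with `assocTwo_or`, this makes the triple join
continuous. -/
theorem assocOne_or (hm : m ≠ 0) (w : I × SqSph m) : assocOne hm w = Sph.base _ ∨
    (assocTwo hm w = Sph.base _ ∧ assocThree hm w = base m) := by
  obtain ⟨τ, x, y⟩ := w
  obtain ⟨u, rfl⟩ := Sph.cell_surjective hm x
  obtain ⟨v, rfl⟩ := Sph.cell_surjective hm y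
  have h0 := τ.2.1
  rcases le_or_gt ((1 + τ) / 4 : ℝ) (u ⟨0, Nat.pos_of_ne_zero hm⟩) with h | h
  · exact Or.inl (smash_eq_base hm (Or.inl (rampMap_eq_base_of_ge hm _ _ _ (by
      change (0 + (1 + τ) / 4 : ℝ) ≤ _; linarith))))
  rcases le_or_gt (1 / 2 : ℝ) (v ⟨0, Nat.pos_of_ne_zero hm⟩) with h' | h'
  · exact Or.inl (smash_eq_base hm (Or.inr (rampMap_eq_base_of_ge hm _ _ _ (by
      change (0 + 1 / 2 : ℝ) ≤ _; linarith))))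
  refine Or.inr ⟨smash_eq_base hm (Or.inl (rampMap_eq_base_of_le hm _ _ _ h.le)),
    -- Here `(1 + τ) / 4` and `1 / 2` are both at most `(2 + τ) / 4`; the second bound uses `0 ≤ τ`.
    Prod.ext (rampMap_eq_base_of_le hm _ _ _ ?_) (rampMap_eq_base_of_le hm _ _ _ ?_)⟩
  · change _ ≤ ((2 + τ) / 4 : ℝ); linarith
  · change _ ≤ ((2 + τ) / 4 : ℝ); linarith

theorem assocTwo_or (hm : m ≠ 0) (w : I × SqSph m) :
    assocTwo hm w = Sph.base _ ∨ assocThree hm w = base m := by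
  obtain ⟨τ, x, y⟩ := w
  obtain ⟨u, rfl⟩ := Sph.cell_surjective hm x
  obtain ⟨v, rfl⟩ := Sph.cell_surjective hm y
  rcases le_or_gt ((2 + τ) / 4 : ℝ) (u ⟨0, Nat.pos_of_ne_zero hm⟩) with h | h
  · exact Or.inl (smash_eq_base hm (Or.inl (rampMap_eq_base_of_ge hm _ _ _ (by
      change ((1 + τ) / 4 + 1 / 4 : ℝ) ≤ _; linarith))))
  rcases le_or_gt ((2 + τ) / 4 : ℝ) (v ⟨0, Nat.pos_of_ne_zero hm⟩) with h' | h'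
  · exact Or.inl (smash_eq_base hm (Or.inr (rampMap_eq_base_of_ge hm _ _ _ (by
      change (τ / 2 + (1 / 2 - τ / 4) : ℝ) ≤ _; linarith))))
  exact Or.inr (Prod.ext (rampMap_eq_base_of_le hm _ _ _ h.le)
    (rampMap_eq_base_of_le hm _ _ _ h'.le))

theorem assocOne_base (hm : m ≠ 0) (τ : I) : assocOne hm (τ, base m) = Sph.base _ :=
  smash_eq_base hm (Or.inl (rampMap_base hm _ _ _ τ))

theorem assocTwo_base (hm : m ≠ 0) (τ : I) : assocTwo hm (τ, base m) = Sph.base _ :=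
  smash_eq_base hm (Or.inl (rampMap_base hm _ _ _ τ))

theorem assocThree_base (hm : m ≠ 0) (τ : I) : assocThree hm (τ, base m) = base m :=
  Prod.ext (rampMap_base hm _ _ _ τ) (rampMap_base hm _ _ _ τ)

/-- At time 0 the two boxes are the halves of `D = [0, 1/2]²` cut at `u₀ = 1/4`, which is the
pattern of `Θ(α ⋆ β, f)`. -/
theorem assocOne_zero (hm : m ≠ 0) (hn : m + m ≠ 0) (p : SqSph m) :
    assocOne hm (0, p) = Sph.lower hn (inner hm p) := by
  change smash hm (boxOneU hm (0, p.1), boxOneV hm (0, p.2)) =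
    Sph.stretch hn _ _ _ (smash hm (Sph.lower hm p.1, Sph.lower hm p.2))
  rw [stretch_smash hm hn]
  congr 2
  · rw [Sph.lower, Sph.stretch_stretch]
    refine rampMap_eq_stretch hm _ _ _ _ _ _ (fun t => ?_) _
    simp only [ramp_coe, ContinuousMap.comp_apply, lowerTime_coe, ContinuousMap.coe_mk, max_min_two_mul, Set.Icc.coe_zero]
    congr 2; ring
  · refine rampMap_eq_stretch hm _ _ _ _ _ _ (fun t => ?_) _
    simp only [ramp_coe, lowerTime_coe, ContinuousMap.coe_mk]
    congr 2; ring

theorem assocTwo_zero (hm : m ≠ 0) (hn : m + m ≠ 0) (p : SqSph m) :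
    assocTwo hm (0, p) = Sph.upper hn (inner hm p) := by
  change smash hm (boxTwoU hm (0, p.1), boxTwoV hm (0, p.2)) =
    Sph.stretch hn _ _ _ (smash hm (Sph.lower hm p.1, Sph.lower hm p.2))
  rw [stretch_smash hm hn]
  congr 2
  · rw [Sph.lower, Sph.stretch_stretch]
    refine rampMap_eq_stretch hm _ _ _ _ _ _ (fun t => ?_) _
    simp only [ramp_coe, ContinuousMap.comp_apply, lowerTime_coe, upperTime_coe,
      ContinuousMap.coe_mk,
      max_min_two_mul_sub, Set.Icc.coe_zero]
    congr 2; ring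
  · refine rampMap_eq_stretch hm _ _ _ _ _ _ (fun t => ?_) _
    simp only [ramp_coe, lowerTime_coe, ContinuousMap.coe_mk, Set.Icc.coe_zero]
    congr 2; ring

theorem assocThree_zero (hm : m ≠ 0) (p : SqSph m) : assocThree hm (0, p) = outer hm p := by
  have (x : Sph m) : boxThree hm (0, x) = Sph.upper hm x := by
    refine rampMap_eq_stretch hm _ _ _ _ _ _ (fun t => ?_) _
    simp only [ramp_coe, upperTime_coe,
      ContinuousMap.coe_mk, Set.Icc.coe_zero]
    congr 2; ring
  exact Prod.ext (this p.1) (this p.2)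

/-- At time 1 the first box is all of `D` and the second is `[1/2, 3/4]²`, the preimage of `D` under
the outer stretch: the pattern of `Θ(α, Θ(β, f))`. -/
theorem assocOne_one (hm : m ≠ 0) (p : SqSph m) : assocOne hm (1, p) = inner hm p := by
  change smash hm (boxOneU hm (1, p.1), boxOneV hm (1, p.2)) =
    smash hm (Sph.lower hm p.1, Sph.lower hm p.2)
  congr 2
  · refine rampMap_eq_stretch hm _ _ _ _ _ _ (fun t => ?_) _
    simp only [ramp_coe, lowerTime_coe, ContinuousMap.coe_mk, Set.Icc.coe_one]
    congr 2; ring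
  · refine rampMap_eq_stretch hm _ _ _ _ _ _ (fun t => ?_) _
    simp only [ramp_coe, lowerTime_coe, ContinuousMap.coe_mk]
    congr 2; ring

theorem assocTwo_one (hm : m ≠ 0) (p : SqSph m) :
    assocTwo hm (1, p) = inner hm (outer hm p) := by
  change smash hm (boxTwoU hm (1, p.1), boxTwoV hm (1, p.2)) =
    smash hm (Sph.lower hm (Sph.upper hm p.1), Sph.lower hm (Sph.upper hm p.2))
  rw [Sph.lower, Sph.upper, Sph.stretch_stretch, Sph.stretch_stretch]
  congr 2
  · refine rampMap_eq_stretch hm _ _ _ _ _ _ (fun t => ?_) _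
    simp only [ramp_coe, ContinuousMap.comp_apply, lowerTime_coe, upperTime_coe,
      ContinuousMap.coe_mk, max_min_two_mul, Set.Icc.coe_one]
    congr 2; ring
  · refine rampMap_eq_stretch hm _ _ _ _ _ _ (fun t => ?_) _
    simp only [ramp_coe, ContinuousMap.comp_apply, lowerTime_coe, upperTime_coe,
      ContinuousMap.coe_mk, max_min_two_mul, Set.Icc.coe_one]
    congr 2; ring

theorem assocThree_one (hm : m ≠ 0) (p : SqSph m) :
    assocThree hm (1, p) = outer hm (outer hm p) := by
  have (x : Sph m) : boxThree hm (1, x) = Sph.upper hm (Sph.upper hm x) := by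
    rw [Sph.upper, Sph.stretch_stretch]
    refine rampMap_eq_stretch hm _ _ _ _ _ _ (fun t => ?_) _
    simp only [ramp_coe, ContinuousMap.comp_apply, upperTime_coe,
      ContinuousMap.coe_mk,
      max_min_two_mul_sub, Set.Icc.coe_one]
    congr 2; ring
  exact Prod.ext (this p.1) (this p.2)

variable [T1Space A]

/-- The homotopy between the two sides of the action law. -/
def assocHomotopy (hm : m ≠ 0) (a : A) :
    C(I × ((PointedMap (Sph (m + m)) A (Sph.base (m + m)) a ×
      PointedMap (Sph (m + m)) A (Sph.base (m + m)) a) × PointedMap (SqSph m) A (base m) a),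
      PointedMap (SqSph m) A (base m) a) where
  toFun w := ⟨⟨fun p => join a (w.2.1.1.1 (assocOne hm (w.1, p)))
      (join a (w.2.1.2.1 (assocTwo hm (w.1, p))) (w.2.2.1 (assocThree hm (w.1, p)))), by
      refine Continuous.join (by fun_prop) (Continuous.join (by fun_prop) (by fun_prop) ?_) ?_
      · intro p
        exact (assocTwo_or hm (w.1, p)).imp (fun h => by rw [h, w.2.1.2.2])
          fun h => by rw [h, w.2.2.2]
      · intro p
        exact (assocOne_or hm (w.1, p)).imp (fun h => by rw [h, w.2.1.1.2])
          fun h => by rw [h.1, h.2, w.2.1.2.2, w.2.2.2, join_of_left rfl]⟩, by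
      change join a _ (join a _ _) = a
      rw [assocOne_base, assocTwo_base, assocThree_base, w.2.1.1.2, w.2.1.2.2, w.2.2.2,
        join_of_left rfl, join_of_left rfl]⟩
  continuous_toFun := by
    -- Continuity into the mapping space is checked after uncurrying, by gluing over time, maps and
    -- points together; evaluation is jointly continuous on the locally compact spheres.
    refine Continuous.subtype_mk (ContinuousMap.continuous_of_continuous_uncurry _ ?_) _
    change Continuous fun q : (I × ((PointedMap (Sph (m + m)) A (Sph.base (m + m)) a ×
      PointedMap (Sph (m + m)) A (Sph.base (m + m)) a) × PointedMap (SqSph m) A (base m) a)) ×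
      SqSph m => join a (q.1.2.1.1.1 (assocOne hm (q.1.1, q.2)))
      (join a (q.1.2.1.2.1 (assocTwo hm (q.1.1, q.2))) (q.1.2.2.1 (assocThree hm (q.1.1, q.2))))
    refine Continuous.join (by fun_prop) (Continuous.join (by fun_prop) (by fun_prop) ?_) ?_
    · intro q
      exact (assocTwo_or hm (q.1.1, q.2)).imp (fun h => by rw [h, q.1.2.1.2.2])
        fun h => by rw [h, q.1.2.2.2]
    · intro q
      exact (assocOne_or hm (q.1.1, q.2)).imp (fun h => by rw [h, q.1.2.1.1.2])
        fun h => by rw [h.1, h.2, q.1.2.1.2.2, q.1.2.2.2, join_of_left rfl]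

/-- The pinch action is compatible with the H-group operation, up to pointed homotopy. -/
theorem pinchAction_mul (hm : m ≠ 0) (hn : m + m ≠ 0) (a : A) :
    ((pinchAction hm a).comp ((Sph.mul hn a).prodMap
      (ContinuousMap.id (PointedMap (SqSph m) A (base m) a)))).HomotopicRel
      (((pinchAction hm a).comp ((ContinuousMap.id _).prodMap (pinchAction hm a))).comp
        (Homeomorph.prodAssoc (PointedMap (Sph (m + m)) A (Sph.base (m + m)) a)
          (PointedMap (Sph (m + m)) A (Sph.base (m + m)) a)
          (PointedMap (SqSph m) A (base m) a) : C(_, _)))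
      {((PointedMap.const _ _, PointedMap.const _ _), PointedMap.const _ _)} := by
  have zero : ∀ w, assocHomotopy hm a (0, w) = ((pinchAction hm a).comp ((Sph.mul hn a).prodMap
      (ContinuousMap.id (PointedMap (SqSph m) A (base m) a)))) w := by
    rintro ⟨⟨α, β⟩, f⟩
    ext p
    refine Eq.trans ?_ (pinchAction_apply' hm _ _ _).symm
    refine Eq.trans ?_ (congrArg₂ (join a) (mul_apply hn α β _).symm rfl)
    rw [join_assoc, ← assocOne_zero, ← assocTwo_zero, ← assocThree_zero]
    rfl
  refine ⟨⟨⟨assocHomotopy hm a, zero, ?_⟩, ?_⟩⟩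
  · rintro ⟨⟨α, β⟩, f⟩
    ext p
    refine Eq.trans ?_ (pinchAction_apply' hm _ _ _).symm
    refine Eq.trans ?_ (congrArg₂ (join a) rfl (pinchAction_apply' hm _ _ _).symm)
    rw [← assocOne_one, ← assocTwo_one, ← assocThree_one]
    rfl
  · rintro τ _ rfl
    refine Eq.trans ?_ (zero _)
    ext p
    change join a a (join a a a) = join a a (join a a a)
    rfl

end SqSph

/-! ### Inverses in the H-group -/

namespace Sph

variable {n : ℕ} {A : Type*} [TopologicalSpace A] {a : A}

/-- The reflection of `S^n` that reverses the first coordinate of the cube. -/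
def reverse (hn : n ≠ 0) : C(Sph n, Sph n) :=
  -- A one-point family is used because `stretch` requires the endpoints to be fixed, while the
  -- reversal swaps them.
  (stretchFamily hn (T := Unit) ⟨fun p => unitInterval.symm p.2, by fun_prop⟩
    (fun _ => Or.inr unitInterval.symm_zero) (fun _ => Or.inl unitInterval.symm_one)).comp
    ((ContinuousMap.const _ ()).prodMk (ContinuousMap.id _))

theorem reverse_cell (hn : n ≠ 0) (t : I^ (Fin n)) :
    reverse hn (cell t) = cell (Function.update t ⟨0, Nat.pos_of_ne_zero hn⟩
      (unitInterval.symm (t ⟨0, Nat.pos_of_ne_zero hn⟩))) :=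
  stretchFamily_cell hn _ (fun _ => Or.inr unitInterval.symm_zero)
    (fun _ => Or.inl unitInterval.symm_one) () t

theorem reverse_base (hn : n ≠ 0) : reverse hn (base n) = base n :=
  stretchFamily_base hn _ (fun _ => Or.inr unitInterval.symm_zero)
    (fun _ => Or.inl unitInterval.symm_one) ()

theorem reverse_reverse (hn : n ≠ 0) (x : Sph n) : reverse hn (reverse hn x) = x := by
  obtain ⟨t, rfl⟩ := cell_surjective hn x
  simp [reverse_cell]

/-- The inverse for the H-group operation of `Map*(S^n, A)`. -/
def inv (hn : n ≠ 0) (α : PointedMap (Sph n) A (base n) a) : PointedMap (Sph n) A (base n) a :=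
  PointedMap.precomp (reverse hn) (reverse_base hn) a α

theorem inv_inv (hn : n ≠ 0) (α : PointedMap (Sph n) A (base n) a) : inv hn (inv hn α) = α := by
  ext x
  exact congrArg α.1 (reverse_reverse hn x)

/-- The path `t ↦ τ * min (2 t) (2 - 2 t)`, which runs to `τ` and back. -/
def foldTime : C(I × I, I) :=
  ⟨fun p => p.1 * min (lowerTime p.2) (unitInterval.symm (upperTime p.2)), by fun_prop⟩

/-- The folding homotopy on the sphere. -/
def fold (hn : n ≠ 0) : C(I × Sph n, Sph n) :=
  stretchFamily hn foldTime (fun τ => Or.inl (by simp [foldTime, lowerTime_zero]))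
    (fun τ => Or.inl (by simp [foldTime, upperTime_one]))

/-- The concatenation runs through `α` in the first coordinate up to 1 and back. Turning round at
`τ` instead of 1 contracts it, and the homotopy is `α` composed with `fold`. -/
theorem mul_inv (hn : n ≠ 0) (α : PointedMap (Sph n) A (base n) a) :
    Joined (mul hn a (α, inv hn α)) (PointedMap.const _ _) := by
  refine Joined.symm (PointedMap.joined_of_homotopicRel
    ⟨⟨⟨α.1.comp (fold hn), fun x => ?_, fun x => ?_⟩, ?_⟩⟩)
  · obtain ⟨t, rfl⟩ := cell_surjective hn x
    change α.1 (fold hn (0, cell t)) = a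
    rw [fold, stretchFamily_cell_eq_base hn _ _ _ (Or.inl (by simp [foldTime])), α.2]
  · obtain ⟨t, rfl⟩ := cell_surjective hn x
    refine Eq.trans ?_ (SqSph.mul_apply hn _ _ _).symm
    change α.1 (fold hn (1, cell t)) =
      join a (α.1 (lower hn (cell t))) (α.1 (reverse hn (upper hn (cell t))))
    rw [fold, stretchFamily_cell]
    -- On each half of the cube one factor is trivial, and the minimum in `foldTime` is attained by
    -- the other branch.
    rcases le_total (t ⟨0, Nat.pos_of_ne_zero hn⟩ : ℝ) (1 / 2) with h | h
    · rw [join_of_right, lower, stretch_cell]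
      · congr 2
        simp only [firstCoord, ContinuousMap.coe_mk]
        congr 1
        simp [foldTime, upperTime_of_le h, unitInterval.le_one']
      · rw [upper, stretch_cell, (cell_eq_base (t := firstCoord hn _ t)).2, reverse_base, α.2]
        exact ⟨⟨0, Nat.pos_of_ne_zero hn⟩, Or.inl (by simp [firstCoord, upperTime_of_le h])⟩
    · rw [join_of_left, upper, stretch_cell, reverse_cell]
      · congr 2
        simp only [firstCoord, ContinuousMap.coe_mk]
        simp [foldTime, lowerTime_of_le h, unitInterval.le_one']
      · rw [lower, stretch_cell, (cell_eq_base (t := firstCoord hn _ t)).2, α.2]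
        exact ⟨⟨0, Nat.pos_of_ne_zero hn⟩, Or.inr (by simp [firstCoord, lowerTime_of_le h])⟩
  · rintro τ _ rfl
    change α.1 (fold hn (τ, base n)) = a
    rw [fold, stretchFamily_base, α.2]

end Sph

/-! ### The homotopy equivalences `Θ(α, -)` -/

namespace SqSph

variable {m : ℕ} {A : Type*} [TopologicalSpace A] {a : A}

/-- The self-map `Θ(α, -)`. -/
def act (hm : m ≠ 0) (α : PointedMap (Sph (m + m)) A (Sph.base (m + m)) a) :
    C(PointedMap (SqSph m) A (base m) a, PointedMap (SqSph m) A (base m) a) :=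
  (pinchAction hm a).comp ((ContinuousMap.const _ α).prodMk (ContinuousMap.id _))

theorem act_homotopic_of_joined (hm : m ≠ 0)
    {α β : PointedMap (Sph (m + m)) A (Sph.base (m + m)) a} (h : Joined α β) :
    (act hm α).Homotopic (act hm β) := by
  obtain ⟨γ⟩ := h
  refine ⟨⟨⟨fun w => pinchAction hm a (γ w.1, w.2), by fun_prop⟩, fun f => ?_, fun f => ?_⟩⟩
  · simp [act]
  · simp [act]

variable [T1Space A]

theorem act_comp_homotopic (hm : m ≠ 0) (hn : m + m ≠ 0)
    (α β : PointedMap (Sph (m + m)) A (Sph.base (m + m)) a) :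
    (act hm (Sph.mul hn a (α, β))).Homotopic ((act hm α).comp (act hm β)) := by
  obtain ⟨H⟩ := pinchAction_mul hm hn a
  refine ⟨⟨⟨fun w => H (w.1, ((α, β), w.2)), by fun_prop⟩, fun f => ?_, fun f => ?_⟩⟩
  · exact H.apply_zero _
  · exact H.apply_one _

/-- The chain is `Θ(α, Θ(α⁻¹, -)) ≃ Θ(α ⋆ α⁻¹, -) ≃ Θ(const, -) ≃ id`. -/
theorem act_inv_homotopic (hm : m ≠ 0) (hn : m + m ≠ 0)
    (α : PointedMap (Sph (m + m)) A (Sph.base (m + m)) a) :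
    ((act hm α).comp (act hm (Sph.inv hn α))).Homotopic (ContinuousMap.id _) :=
  ((act_comp_homotopic hm hn α (Sph.inv hn α)).symm.trans
    (act_homotopic_of_joined hm (Sph.mul_inv hn α))).trans (by
      obtain ⟨H⟩ := pinchAction_const hm a
      exact ⟨H.toHomotopy⟩)

/-- No second folding homotopy is needed: `Sph.inv` is strictly involutive, so this is the previous
statement for the inverse. -/
theorem inv_act_homotopic (hm : m ≠ 0) (hn : m + m ≠ 0)
    (α : PointedMap (Sph (m + m)) A (Sph.base (m + m)) a) :
    ((act hm (Sph.inv hn α)).comp (act hm α)).Homotopic (ContinuousMap.id _) := by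
  simpa only [Sph.inv_inv] using act_inv_homotopic hm hn (Sph.inv hn α)

/-- The homotopy equivalence `Θ(α, -)`. -/
def actEquiv (hm : m ≠ 0) (hn : m + m ≠ 0)
    (α : PointedMap (Sph (m + m)) A (Sph.base (m + m)) a) :
    PointedMap (SqSph m) A (base m) a ≃ₕ PointedMap (SqSph m) A (base m) a where
  toFun := act hm α
  invFun := act hm (Sph.inv hn α)
  left_inv := inv_act_homotopic hm hn α
  right_inv := act_inv_homotopic hm hn α

end SqSph

/-! ### Restriction of homotopy equivalences to connected components -/

section components

variable {M N : Type*} [TopologicalSpace M] [TopologicalSpace N]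

theorem ContinuousMap.Homotopic.joined {F G : C(M, N)} (h : F.Homotopic G) (x : M) :
    Joined (F x) (G x) := by
  obtain ⟨H⟩ := h
  exact ⟨H.evalAt x⟩

theorem Joined.connectedComponent_eq {x y : M} (h : Joined x y) :
    connectedComponent x = connectedComponent y :=
  _root_.connectedComponent_eq (pathComponent_subset_component _ h)

/-- A continuous map restricts to a map from the component of `x` to the component of its image. -/
def ContinuousMap.restrictComponent (F : C(M, N)) {x : M} {y : N}
    (h : connectedComponent (F x) = connectedComponent y) :
    C(connectedComponent x, connectedComponent y) where
  toFun z := ⟨F z, h ▸ F.continuous.image_connectedComponent_subset x ⟨z, z.2, rfl⟩⟩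
  continuous_toFun := by fun_prop

/-- The track of a point under the homotopy is connected and ends at that point, so the homotopy
never leaves the component. -/
theorem ContinuousMap.restrictComponent_homotopic_id {F : C(M, N)} {G : C(N, M)}
    (hGF : (G.comp F).Homotopic (ContinuousMap.id _)) {x : M} {y : N}
    (h : connectedComponent (F x) = connectedComponent y)
    (h' : connectedComponent (G y) = connectedComponent x) :
    ((G.restrictComponent h').comp (F.restrictComponent h)).Homotopic (ContinuousMap.id _) := by
  obtain ⟨H⟩ := hGF
  have key (τ : I) (z : connectedComponent x) : H (τ, (z : M)) ∈ connectedComponent x := by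
    have h1 := (isPreconnected_univ.image (fun t : I => H (t, (z : M))) (by fun_prop))
      |>.subset_connectedComponent ⟨1, trivial, H.apply_one _⟩ ⟨τ, trivial, rfl⟩
    exact (connectedComponent_eq z.2).symm.subset h1
  refine ⟨⟨⟨fun w => ⟨H (w.1, w.2), key _ _⟩,
    (by fun_prop : Continuous fun w : I × connectedComponent x => H (w.1, (w.2 : M))).subtype_mk _⟩,
    fun z => ?_, fun z => ?_⟩⟩
  · exact Subtype.ext (H.apply_zero _)
  · exact Subtype.ext (H.apply_one _)

/-- A homotopy equivalence restricts to homotopy equivalences of connected components. -/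
def ContinuousMap.HomotopyEquiv.restrictComponent (e : M ≃ₕ N) {x : M} {y : N}
    (h : connectedComponent (e x) = connectedComponent y) :
    connectedComponent x ≃ₕ connectedComponent y :=
  have h' : connectedComponent (e.invFun y) = connectedComponent x := by
    -- The inverse sends the common component of `e x` and `y` into the component of `e.invFun (e
    -- x)`, and that point is joined to `x`.
    have h1 : e.invFun y ∈ connectedComponent (e.invFun (e x)) :=
      e.invFun.continuous.image_connectedComponent_subset _
        ⟨y, h ▸ mem_connectedComponent, rfl⟩
    rw [← _root_.connectedComponent_eq h1]
    exact (e.left_inv.joined x).connectedComponent_eq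
  { toFun := e.toFun.restrictComponent h
    invFun := e.invFun.restrictComponent h'
    left_inv := ContinuousMap.restrictComponent_homotopic_id e.left_inv h h'
    right_inv := ContinuousMap.restrictComponent_homotopic_id e.right_inv h' h }

end components

/-! ### Transitivity from the orbit of the constant map -/

/-- If every pointed map is in the orbit of the constant map up to homotopy, then any two are
in the same orbit up to homotopy. -/
theorem SqSph.exists_joined_act {m : ℕ} {A : Type*} [TopologicalSpace A] [T1Space A] {a : A}
    (hm : m ≠ 0) (hn : m + m ≠ 0)
    (h : ∀ f : PointedMap (SqSph m) A (base m) a, ∃ α, Joined (act hm α (PointedMap.const _ _)) f)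
    (f g : PointedMap (SqSph m) A (base m) a) : ∃ α, Joined (act hm α f) g := by
  obtain ⟨α, hα⟩ := h f
  obtain ⟨β, hβ⟩ := h g
  -- The inverse of `α` leads from `f` back to the constant map, and `β` then leads to `g`.
  refine ⟨Sph.mul hn a (β, Sph.inv hn α), ?_⟩
  refine ((act_comp_homotopic hm hn β (Sph.inv hn α)).joined f).trans (Joined.trans ?_ hβ)
  refine Joined.map ?_ (act hm β).continuous
  exact (hα.symm.map (act hm (Sph.inv hn α)).continuous).trans
    ((inv_act_homotopic hm hn α).joined _)

/-! ### Maps into spheres of larger dimension -/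

namespace Sph

variable {n : ℕ} {X : Type*} [TopologicalSpace X]

/-- The radial projection of a map without zeros to the sphere. -/
def normalize (f : C(X, EuclideanSpace ℝ (Fin (n + 1)))) (hf : ∀ x, f x ≠ 0) : C(X, Sph n) where
  toFun x := ⟨‖f x‖⁻¹ • f x, by
    rw [mem_sphere_zero_iff_norm, norm_smul, norm_inv, norm_norm,
      inv_mul_cancel₀ (norm_ne_zero_iff.2 (hf x))]⟩
  continuous_toFun := by
    have h : ∀ x, ‖f x‖ ≠ 0 := fun x => norm_ne_zero_iff.2 (hf x)
    have : Continuous fun x => ‖f x‖⁻¹ • f x := by fun_prop (disch := assumption)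
    exact this.subtype_mk _

theorem normalize_eq {f : C(X, EuclideanSpace ℝ (Fin (n + 1)))} {hf : ∀ x, f x ≠ 0} {x : X}
    {y : Sph n} (h : f x = y) : normalize f hf x = y := by
  have hy := mem_sphere_zero_iff_norm.1 y.2
  ext1
  change ‖f x‖⁻¹ • f x = y
  rw [h, hy, inv_one, one_smul]

theorem normalize_congr {Y : Type*} [TopologicalSpace Y] {f : C(X, EuclideanSpace ℝ (Fin (n + 1)))}
    {g : C(Y, EuclideanSpace ℝ (Fin (n + 1)))} {hf : ∀ x, f x ≠ 0} {hg : ∀ y, g y ≠ 0} {x : X}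
    {y : Y} (h : f x = g y) : normalize f hf x = normalize g hg y :=
  Subtype.ext (show ‖f x‖⁻¹ • f x = ‖g y‖⁻¹ • g y by rw [h])

/-- Maps to the sphere that are close to each other are homotopic, relative to the set on which
they agree. -/
theorem homotopicRel_normalize (f : C(X, Sph n)) (q : C(X, EuclideanSpace ℝ (Fin (n + 1))))
    (hq : ∀ x, q x ≠ 0) (hd : ∀ x, dist (q x) (f x) < 1) (S : Set X) (hS : ∀ x ∈ S, q x = f x) :
    f.HomotopicRel (normalize q hq) S := by
  let F : C(I × X, EuclideanSpace ℝ (Fin (n + 1))) :=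
    ⟨fun w => (f w.2 : EuclideanSpace ℝ (Fin (n + 1))) + (w.1 : ℝ) • (q w.2 - f w.2), by fun_prop⟩
  -- A zero on the segment from `f x` to `q x` would put the unit vector `f x` at distance at most
  -- `dist (q x) (f x) < 1` from it.
  have hF : ∀ w, F w ≠ 0 := by
    rintro ⟨t, x⟩ h
    have h1 : (f x : EuclideanSpace ℝ (Fin (n + 1))) = -((t : ℝ) • (q x - f x)) :=
      eq_neg_of_add_eq_zero_left h
    have h2 : ‖(f x : EuclideanSpace ℝ (Fin (n + 1)))‖ = 1 := mem_sphere_zero_iff_norm.1 (f x).2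
    rw [h1, norm_neg, norm_smul, Real.norm_of_nonneg t.2.1, ← dist_eq_norm] at h2
    have := mul_le_of_le_one_left (dist_nonneg (x := q x) (y := (f x).1)) t.2.2
    linarith [hd x]
  have h0 (x : X) : normalize F hF (0, x) = f x := normalize_eq (by simp [F])
  have h1 (x : X) : normalize F hF (1, x) = normalize q hq x :=
    normalize_congr (f := F) (g := q) (by simp [F])
  have h2 (t : I) (x : X) (hx : x ∈ S) : normalize F hF (t, x) = f x :=
    normalize_eq (by simp [F, hS x hx])
  exact ⟨⟨⟨normalize F hF, h0, h1⟩, h2⟩⟩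

/-- A map to the sphere that misses a point is nullhomotopic, relative to any fibre. -/
theorem homotopicRel_const_of_ne (f : C(X, Sph n)) (v : Sph n) (hv : ∀ x, f x ≠ v) (b : Sph n)
    (S : Set X) (hS : ∀ x ∈ S, f x = b) (hb : b ≠ v) :
    f.HomotopicRel (ContinuousMap.const X b) S := by
  have hv1 : ‖(v : EuclideanSpace ℝ (Fin (n + 1)))‖ = 1 := mem_sphere_zero_iff_norm.1 v.2
  -- Stereographic projection from the missed point `v` moves the problem to a vector space, where
  -- the linear homotopy to `e b` is constant wherever `f` is already `b`.
  let e := stereographic hv1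
  have hs : ∀ y, y ≠ v → y ∈ e.source := fun y hy => by
    rw [stereographic_source]; exact hy
  have ht : e.target = Set.univ := stereographic_target hv1
  have he : Continuous fun x => e (f x) :=
    e.continuousOn.comp_continuous f.continuous fun x => hs _ (hv x)
  have hsymm : Continuous e.symm := by
    rw [← continuousOn_univ, ← ht]; exact e.continuousOn_symm
  refine ⟨⟨⟨⟨fun w => e.symm ((1 - (w.1 : ℝ)) • e (f w.2) + (w.1 : ℝ) • e b), ?_⟩, ?_, ?_⟩, ?_⟩⟩
  · have h1 : Continuous fun w : I × X => e (f w.2) := he.comp continuous_snd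
    have h2 : Continuous fun w : I × X => (w.1 : ℝ) := by fun_prop
    exact hsymm.comp (((continuous_const.sub h2).smul h1).add (h2.smul continuous_const))
  · intro x; simp [e.left_inv (hs _ (hv x))]
  · intro x; simp [e.left_inv (hs _ hb)]
  · intro t x hx
    change e.symm ((1 - (t : ℝ)) • e (f x) + (t : ℝ) • e b) = f x
    rw [hS x hx, ← add_smul, sub_add_cancel, one_smul, e.left_inv (hs _ hb)]

/-- The retraction of `ℝ^m` onto the cube. -/
def clampCube (m : ℕ) : C(Fin m → ℝ, I^ (Fin m)) where
  toFun t i := Set.projIcc 0 1 zero_le_one (t i)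
  continuous_toFun := by fun_prop

/-- A map from `S^m` to a Euclidean space can be approximated, preserving the image of the base
point, by a map that is smooth in the coordinates of the cube. -/
theorem exists_smooth_approx {m : ℕ} (hm : m ≠ 0) {E : Type*} [NormedAddCommGroup E]
    [NormedSpace ℝ E] (f : C(Sph m, E)) : ∃ q : C(Sph m, E), ∃ g : (Fin m → ℝ) → E,
      ContDiff ℝ 1 g ∧ (∀ t : I^ (Fin m), q (cell t) = g fun i => t i) ∧
      (∀ x, dist (q x) (f x) < 1) ∧ q (base m) = f (base m) := by
  -- Subtracting the value at the base point makes the function vanish on the boundary of the cube.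
  -- The approximation is chosen with support inside the support of this function, so it vanishes
  -- there too and descends to the sphere.
  have hF : Continuous fun t => f (cell (clampCube m t)) - f (base m) := by fun_prop
  obtain ⟨g, hg, hd, hs⟩ := hF.exists_contDiff_approx 1 continuous_const (fun _ => one_pos)
  have hc (t : I^ (Fin m)) : clampCube m (fun i => t i) = t := by
    ext i; simp [clampCube]
  have hb {t : I^ (Fin m)} (ht : t ∈ Cube.boundary (Fin m)) : g (fun i => t i) = 0 := by
    by_contra h
    have := hs h
    rw [Function.mem_support, hc, cell_eq_base.2 ht, sub_self] at this
    exact this rfl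
  let G : C(I^ (Fin m), E) := ⟨fun t => g (fun i => t i) + f (base m), by
    have := hg.continuous
    fun_prop⟩
  have hG : Function.FactorsThrough G (cell (n := m)) := by
    intro s t h
    rcases cell_inj h with rfl | ⟨h1, h2⟩
    · rfl
    · change g _ + _ = g _ + _
      rw [hb h1, hb h2]
  have hq (t : I^ (Fin m)) : (cell_isQuotientMap hm).lift G hG (cell t) = G t :=
    DFunLike.congr_fun ((cell_isQuotientMap hm).lift_comp G hG) t
  refine ⟨(cell_isQuotientMap hm).lift G hG, fun t => g t + f (base m), ?_, hq, ?_, ?_⟩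
  · exact (hg.of_le (by simp)).add contDiff_const
  · intro x
    obtain ⟨t, rfl⟩ := cell_surjective hm x
    rw [hq]
    have := hd fun i => t i
    rw [hc, dist_eq_norm] at this
    rw [dist_eq_norm]
    convert this using 2
    change g _ + _ - _ = _
    abel
  · obtain ⟨t, ht⟩ := cell_surjective hm (base m)
    rw [← ht, hq, ht]
    change g _ + _ = _
    rw [hb (cell_eq_base.1 ht), zero_add]

/-- A pointed map from a sphere to a sphere of larger dimension is nullhomotopic. -/
theorem homotopicRel_const {m : ℕ} (hm : m ≠ 0) (hmn : m < n) (f : C(Sph m, Sph n))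
    (hf : f (base m) = base n) :
    f.HomotopicRel (ContinuousMap.const _ (base n)) {base m} := by
  obtain ⟨q, g, hg, hqg, hd, hb⟩ := exists_smooth_approx hm
    ((⟨Subtype.val, continuous_subtype_val⟩ : C(Sph n, EuclideanSpace ℝ (Fin (n + 1)))).comp f)
  have hq (x : Sph m) : q x ≠ 0 := by
    intro h
    have h1 := hd x
    have h2 : ‖(f x : EuclideanSpace ℝ (Fin (n + 1)))‖ = 1 := mem_sphere_zero_iff_norm.1 (f x).2
    rw [h, dist_zero_left] at h1
    exact h1.ne h2
  -- The cone over the image is parametrised by `m + 1` real variables in a space of dimension `n +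
  -- 1 > m + 1`, so its complement is dense. A vector outside the cone gives a direction that the
  -- radial projection of `q` misses.
  have hcone : ContDiff ℝ 1 fun w : ℝ × (Fin m → ℝ) => w.1 • g w.2 :=
    contDiff_fst.smul (hg.comp contDiff_snd)
  obtain ⟨v, hv⟩ := (hcone.dense_compl_range_of_finrank_lt_finrank (by
    simp [Module.finrank_prod]; omega)).nonempty
  have hv0 : v ≠ 0 := by
    rintro rfl
    exact hv ⟨(0, 0), by simp⟩
  have hmiss (x : Sph m) (r : ℝ) : r • q x ≠ v := by
    intro h
    obtain ⟨t, rfl⟩ := cell_surjective hm x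
    exact hv ⟨(r, fun i => t i), by rw [← h, hqg]⟩
  let w : Sph n := normalize (ContinuousMap.const Unit v) (fun _ => hv0) ()
  have hw (x : Sph m) : normalize q hq x ≠ w := by
    intro h
    refine hmiss x (‖v‖ * ‖q x‖⁻¹) ?_
    have h1 := congrArg Subtype.val h
    rw [mul_smul]
    change ‖q x‖⁻¹ • q x = ‖v‖⁻¹ • v at h1
    rw [h1, smul_smul, mul_inv_cancel₀ (norm_ne_zero_iff.2 hv0), one_smul]
  have hbase : normalize q hq (base m) = base n := by
    rw [← hf]; exact normalize_eq hb
  refine (homotopicRel_normalize f q hq hd {base m} ?_).trans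
    (homotopicRel_const_of_ne _ w hw (base n) {base m} ?_ ?_)
  · rintro _ rfl; exact hb
  · rintro _ rfl; exact hbase
  · exact hbase ▸ hw (base m)

end Sph

/-! ### A collar of the base point -/

namespace Sph

variable {m : ℕ}

/-- The height `max 0 x_m`, which is `1` at the base point. -/
def height : C(Sph m, I) where
  toFun x := Set.projIcc 0 1 zero_le_one (x.1 (Fin.last m))
  continuous_toFun := by fun_prop

theorem height_base : height (base m) = 1 :=
  Set.projIcc_of_right_le zero_le_one (by rw [(eq_base_iff (base m)).1 rfl])

/-- A homotopy, before normalization, that pushes the upper hemisphere to the base point. -/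
def pushLine : C(I × Sph m, EuclideanSpace ℝ (Fin (m + 1))) where
  toFun w := (1 - (w.1 : ℝ) * min 1 (1 + w.2.1 (Fin.last m))) • w.2.1 +
    ((w.1 : ℝ) * min 1 (1 + w.2.1 (Fin.last m))) • (base m).1
  continuous_toFun := by fun_prop

/-- A convex combination of two unit vectors vanishes only if they are opposite with weights 1/2.
The point would then be the south pole, where the factor `min 1 (1 + x_m)` makes the weight 0. -/
theorem pushLine_ne_zero (w : I × Sph m) : pushLine w ≠ 0 := by
  obtain ⟨τ, x⟩ := w
  intro h
  have hx : ‖(x : EuclideanSpace ℝ (Fin (m + 1)))‖ = 1 := mem_sphere_zero_iff_norm.1 x.2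
  have hb : ‖(base m : EuclideanSpace ℝ (Fin (m + 1)))‖ = 1 := mem_sphere_zero_iff_norm.1 (base m).2
  have hl : |x.1 (Fin.last m)| ≤ 1 := (PiLp.norm_apply_le x.1 (Fin.last m)).trans hx.le
  have hl' := (abs_le.1 hl).1
  set c : ℝ := τ * min 1 (1 + x.1 (Fin.last m)) with hc
  have hm0 : 0 ≤ min 1 (1 + x.1 (Fin.last m)) := le_min zero_le_one (by linarith)
  have hm1 : min 1 (1 + x.1 (Fin.last m)) ≤ 1 := min_le_left _ _
  have hc0 : 0 ≤ c := mul_nonneg τ.2.1 hm0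
  have hc1 : c ≤ 1 := mul_le_one₀ τ.2.2 hm0 hm1
  have h' : (1 - c) • x.1 + c • (base m).1 = 0 := h
  have h1 := congrArg norm (eq_neg_of_add_eq_zero_left h')
  rw [norm_neg, norm_smul, norm_smul, hx, hb, Real.norm_of_nonneg hc0,
    Real.norm_of_nonneg (by linarith), mul_one, mul_one] at h1
  have h2 : (1 - c) * x.1 (Fin.last m) + c * (base m).1 (Fin.last m) = 0 :=
    congrArg (fun v : EuclideanSpace ℝ (Fin (m + 1)) => v (Fin.last m)) h'
  rw [(eq_base_iff (base m)).1 rfl] at h2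
  have h3 : c = 1 / 2 := by linarith
  have h4 : x.1 (Fin.last m) = -1 := by rw [h3] at h2; linarith
  rw [h4] at hc
  simp at hc
  linarith

/-- A map that is homotopic to the identity and collapses the upper hemisphere. -/
def push : C(I × Sph m, Sph m) := normalize pushLine pushLine_ne_zero

theorem push_zero (x : Sph m) : push (0, x) = x := normalize_eq (by simp [pushLine])

theorem push_base (τ : I) : push (τ, base m) = base m :=
  normalize_eq (by
    change (1 - (_ : ℝ)) • (base m).1 + (_ : ℝ) • (base m).1 = (base m).1
    rw [← add_smul, sub_add_cancel, one_smul])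

/-- The factor `min 1 (1 + x_m)` is 1 on the upper hemisphere, and the height is 0 on the lower one.
The two conditions are closed and cover the sphere; this is the collar for extending homotopies from
the wedge. -/
theorem height_or_push (x : Sph m) : height x = 0 ∨ push (1, x) = base m := by
  rcases le_total (x.1 (Fin.last m)) 0 with h | h
  · exact Or.inl (Set.projIcc_of_le_left zero_le_one h)
  · refine Or.inr (normalize_eq ?_)
    change (1 - (_ : ℝ)) • x.1 + (_ : ℝ) • (base m).1 = (base m).1
    rw [min_eq_left (by linarith)]
    simp

end Sph

/-! ### Deforming maps of the squared sphere to maps through the smash product -/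

namespace SqSph

variable {m : ℕ} {Y : Type*} [TopologicalSpace Y]

open Classical in
/-- A map that is nullhomotopic on both factors of the wedge is homotopic to one that is constant
on the wedge. -/
theorem exists_homotopicRel_const_wedge (f : C(SqSph m, Y)) (b : Y)
    (H : (f.comp ((ContinuousMap.id _).prodMk (ContinuousMap.const _ (Sph.base m)))).HomotopyRel
      (ContinuousMap.const _ b) {Sph.base m})
    (K : (f.comp ((ContinuousMap.const _ (Sph.base m)).prodMk (ContinuousMap.id _))).HomotopyRel
      (ContinuousMap.const _ b) {Sph.base m}) :
    ∃ g : C(SqSph m, Y), f.HomotopicRel g {base m} ∧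
      ∀ x y, x = Sph.base m ∨ y = Sph.base m → g (x, y) = b := by
  have hfb : f (Sph.base m, Sph.base m) = b := by
    have h1 := H.eq_fst 1 (x := Sph.base m) rfl
    rw [H.apply_one] at h1
    exact h1.symm
  have hH (τ : I) : H (τ, Sph.base m) = b := (H.eq_fst τ rfl).trans hfb
  have hK (τ : I) : K (τ, Sph.base m) = b := (K.eq_fst τ rfl).trans hfb
  have hH0 (x : Sph m) : H (0, x) = f (x, Sph.base m) := H.apply_zero x
  have hK0 (x : Sph m) : K (0, x) = f (Sph.base m, x) := K.apply_zero x
  have hH1 (x : Sph m) : H (1, x) = b := H.apply_one x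
  have hK1 (x : Sph m) : K (1, x) = b := K.apply_one x
  let s : C(Sph m, Sph m) := ⟨fun x => Sph.push (1, x), by fun_prop⟩
  have hs (x : Sph m) : Sph.height x = 0 ∨ s x = Sph.base m := Sph.height_or_push x
  have hsb : s (Sph.base m) = Sph.base m := Sph.push_base 1
  -- After `f` is replaced by `f ∘ (s × s)`, the nullhomotopy of each axis runs on the collar of
  -- that axis, for the time `τ * height`. That time is 0 where the collar meets the rest, and all
  -- of `τ` on the axis itself. Where both collars meet, both homotopies sit at the base point and
  -- have the value `b`.
  let F : I × SqSph m → Y := fun w =>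
    if s w.2.1 = Sph.base m then K (w.1 * Sph.height w.2.1, s w.2.2)
    else if s w.2.2 = Sph.base m then H (w.1 * Sph.height w.2.2, s w.2.1)
    else f (s w.2.1, s w.2.2)
  have FK (τ : I) (x y : Sph m) (h : s x = Sph.base m) :
      F (τ, x, y) = K (τ * Sph.height x, s y) := if_pos h
  have FH (τ : I) (x y : Sph m) (h : s y = Sph.base m) :
      F (τ, x, y) = H (τ * Sph.height y, s x) := by
    by_cases hx : s x = Sph.base m
    · rw [FK τ x y hx, h, hx, hK, hH]
    · exact (if_neg hx).trans (if_pos h)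
  have Ff (τ : I) (x y : Sph m) (hx : Sph.height x = 0) (hy : Sph.height y = 0) :
      F (τ, x, y) = f (s x, s y) := by
    by_cases h : s x = Sph.base m
    · rw [FK τ x y h, hx, mul_zero, hK0, h]
    by_cases h' : s y = Sph.base m
    · rw [FH τ x y h', hy, mul_zero, hH0, h']
    · exact (if_neg h).trans (if_neg h')
  have hF : Continuous F := by
    let CK : Set (I × SqSph m) := {w | s w.2.1 = Sph.base m}
    let CH : Set (I × SqSph m) := {w | s w.2.2 = Sph.base m}
    let Cf : Set (I × SqSph m) := {w | Sph.height w.2.1 = 0} ∩ {w | Sph.height w.2.2 = 0}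
    have cK : IsClosed CK := isClosed_eq (by fun_prop) continuous_const
    have cH : IsClosed CH := isClosed_eq (by fun_prop) continuous_const
    have cf : IsClosed Cf := (isClosed_eq (by fun_prop) continuous_const).inter
      (isClosed_eq (by fun_prop) continuous_const)
    have hU : (Set.univ : Set (I × SqSph m)) = CK ∪ CH ∪ Cf := by
      refine (Set.eq_univ_of_forall fun w => ?_).symm
      rcases hs w.2.1 with h1 | h1
      · rcases hs w.2.2 with h2 | h2
        · exact Or.inr ⟨h1, h2⟩
        · exact Or.inl (Or.inr h2)
      · exact Or.inl (Or.inl h1)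
    rw [← continuousOn_univ, hU]
    refine ContinuousOn.union_of_isClosed (ContinuousOn.union_of_isClosed ?_ ?_ cK cH) ?_
      (cK.union cH) cf
    · exact (by fun_prop : Continuous fun w : I × SqSph m =>
        K (w.1 * Sph.height w.2.1, s w.2.2)).continuousOn.congr fun w hw => FK w.1 w.2.1 w.2.2 hw
    · exact (by fun_prop : Continuous fun w : I × SqSph m =>
        H (w.1 * Sph.height w.2.2, s w.2.1)).continuousOn.congr fun w hw => FH w.1 w.2.1 w.2.2 hw
    · exact (by fun_prop : Continuous fun w : I × SqSph m =>
        f (s w.2.1, s w.2.2)).continuousOn.congr fun w hw => Ff w.1 w.2.1 w.2.2 hw.1 hw.2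
  have F0 (x y : Sph m) : F (0, x, y) = f (s x, s y) := by
    by_cases h : s x = Sph.base m
    · rw [FK 0 x y h, zero_mul, hK0, h]
    by_cases h' : s y = Sph.base m
    · rw [FH 0 x y h', zero_mul, hH0, h']
    · exact (if_neg h).trans (if_neg h')
  have Fb (τ : I) : F (τ, base m) = b := by
    change F (τ, Sph.base m, Sph.base m) = b
    rw [FK _ _ _ hsb, hsb, hK]
  refine ⟨⟨fun p => F (1, p), by fun_prop⟩, ?_, ?_⟩
  · refine ContinuousMap.HomotopicRel.trans (g := f.comp (s.prodMap s))
      ⟨⟨⟨f.comp ⟨fun w => (Sph.push (w.1, w.2.1), Sph.push (w.1, w.2.2)), by fun_prop⟩,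
        fun p => ?_, fun p => rfl⟩, ?_⟩⟩
      ⟨⟨⟨⟨F, hF⟩, fun p => F0 p.1 p.2, fun p => rfl⟩, ?_⟩⟩
    · change f (Sph.push (0, p.1), Sph.push (0, p.2)) = f p
      rw [Sph.push_zero, Sph.push_zero]
    · rintro τ _ rfl
      change f (Sph.push (τ, Sph.base m), Sph.push (τ, Sph.base m)) = _
      rw [Sph.push_base]; rfl
    · rintro τ _ rfl
      change F (τ, base m) = f (s (Sph.base m), s (Sph.base m))
      rw [Fb, hsb, hfb]
  · rintro x y (rfl | rfl)
    · change F (1, Sph.base m, y) = b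
      rw [FK _ _ _ hsb, one_mul, Sph.height_base, hK1]
    · change F (1, x, Sph.base m) = b
      rw [FH _ _ _ hsb, one_mul, Sph.height_base, hH1]

theorem smash_isQuotientMap (hm : m ≠ 0) : Topology.IsQuotientMap (smash hm) := by
  refine (smash hm).continuous.isClosedMap.isQuotientMap (smash hm).continuous fun z => ?_
  obtain ⟨t, rfl⟩ := Sph.cell_surjective (by omega : m + m ≠ 0) z
  refine ⟨(Sph.cell fun i => t (Fin.castAdd m i), Sph.cell fun i => t (Fin.natAdd m i)), ?_⟩
  rw [smash_cell]
  congr 1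
  exact Fin.append_castAdd_natAdd

/-- The only identification on `S^m × S^m` is the collapse of the wedge, so maps that are constant
on the wedge factor through `S^(2m)`. -/
theorem smash_inj (hm : m ≠ 0) {p q : SqSph m} (h : smash hm p = smash hm q) : p = q ∨
    ((p.1 = Sph.base m ∨ p.2 = Sph.base m) ∧ (q.1 = Sph.base m ∨ q.2 = Sph.base m)) := by
  obtain ⟨x, y⟩ := p
  obtain ⟨x', y'⟩ := q
  obtain ⟨u, rfl⟩ := Sph.cell_surjective hm x
  obtain ⟨v, rfl⟩ := Sph.cell_surjective hm y
  obtain ⟨u', rfl⟩ := Sph.cell_surjective hm x'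
  obtain ⟨v', rfl⟩ := Sph.cell_surjective hm y'
  rw [smash_cell, smash_cell] at h
  simp only [Sph.cell_eq_base]
  rcases Sph.cell_inj h with h | ⟨h, h'⟩
  · left
    have hu : u = u' := funext fun i => by
      simpa only [Fin.append_left] using congrFun h (Fin.castAdd m i)
    have hv : v = v' := funext fun i => by
      simpa only [Fin.append_right] using congrFun h (Fin.natAdd m i)
    rw [hu, hv]
  · exact Or.inr ⟨append_boundary.1 h, append_boundary.1 h'⟩

/-- If pointed maps `S^m → A` are nullhomotopic, then every pointed map `(S^m)² → A` is in the orbit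
of the constant map up to homotopy. -/
theorem exists_joined_act_const {A : Type*} [TopologicalSpace A] {a : A} (hm : m ≠ 0)
    (h : ∀ f : C(Sph m, A), f (Sph.base m) = a →
      f.HomotopicRel (ContinuousMap.const _ a) {Sph.base m})
    (f : PointedMap (SqSph m) A (base m) a) :
    ∃ α, Joined (act hm α (PointedMap.const _ _)) f := by
  obtain ⟨H⟩ := h (f.1.comp ((ContinuousMap.id _).prodMk (ContinuousMap.const _ (Sph.base m)))) f.2
  obtain ⟨K⟩ := h (f.1.comp ((ContinuousMap.const _ (Sph.base m)).prodMk (ContinuousMap.id _))) f.2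
  obtain ⟨g, hg, hgb⟩ := exists_homotopicRel_const_wedge f.1 a H K
  have hfac : Function.FactorsThrough g (smash hm) := by
    intro p q hpq
    rcases smash_inj hm hpq with rfl | ⟨h1, h2⟩
    · rfl
    · exact (hgb p.1 p.2 h1).trans (hgb q.1 q.2 h2).symm
  have hα (p : SqSph m) : (smash_isQuotientMap hm).lift g hfac (smash hm p) = g p :=
    DFunLike.congr_fun ((smash_isQuotientMap hm).lift_comp g hfac) p
  have hgbase : g (base m) = a := hgb _ _ (Or.inl rfl)
  let α : PointedMap (Sph (m + m)) A (Sph.base (m + m)) a :=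
    ⟨(smash_isQuotientMap hm).lift g hfac, by
      rw [← smash_eq_base hm (p := Sph.base m) (q := Sph.base m) (Or.inl rfl), hα]
      exact hgbase⟩
  let g' : PointedMap (SqSph m) A (base m) a := ⟨g, hgbase⟩
  have hll : (Sph.lower hm).prodMap (Sph.lower hm) (base m) = base m :=
    Prod.ext (Sph.stretch_base hm _ _ _) (Sph.stretch_base hm _ _ _)
  -- With `f` constant only `α ∘ inner` remains, which is `g ∘ (lower × lower)` by the choice of
  -- `α`; and `lower × lower` is homotopic to the identity.
  have hact : act hm α (PointedMap.const _ _) = PointedMap.precomp _ hll a g' := by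
    ext p
    refine (pinchAction_apply hm α _ p).trans ((join_of_left rfl).trans ?_)
    exact hα _
  have hid : PointedMap.precomp (ContinuousMap.id _) (ContinuousMap.id_apply _) a g' = g' := rfl
  have hhom : ((Sph.lower hm).prodMap (Sph.lower hm)).HomotopicRel (ContinuousMap.id _) {base m} :=
    (Sph.stretch_homotopicRel_id hm _ _ _).prodMap_singleton
      (Sph.stretch_homotopicRel_id hm _ _ _)
  obtain ⟨P⟩ := PointedMap.precomp_homotopicRel hll (ContinuousMap.id_apply _) hhom a
  refine ⟨α, (Joined.trans ?_ (PointedMap.joined_of_homotopicRel (g := g') hg).symm)⟩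
  rw [hact]
  exact ContinuousMap.Homotopic.joined ⟨P.toHomotopy⟩ g'

end SqSph

end

/-- The connected components of `Map*((S^(2k-1))², S^(2k))`, `k ≥ 1`, are all homotopy equivalent,
through the pinch action `Θ` of the H-group `Map*(S^(4k-2), S^(2k))`: `Θ` is an action up to pointed
homotopy, every `Θ(α, -)` is a homotopy equivalence, and any two connected components
are related by a homotopy equivalence which is the restriction of some `Θ(α, -)`. -/
theorem mainTheorem10 (k : ℕ) (hk : 1 ≤ k) :
    ContinuousMap.HomotopicRel
      ((theta hk).comp ((ContinuousMap.const (SqSphMaps k) (PointedMap.const _ _)).prodMk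
        (ContinuousMap.id (SqSphMaps k))))
      (ContinuousMap.id (SqSphMaps k))
      {PointedMap.const _ _} ∧
    ContinuousMap.HomotopicRel
      ((theta hk).comp ((sphMul hk).prodMap (ContinuousMap.id (SqSphMaps k))))
      (((theta hk).comp ((ContinuousMap.id (SphMaps k)).prodMap (theta hk))).comp
        (Homeomorph.prodAssoc (SphMaps k) (SphMaps k) (SqSphMaps k) :
          C((SphMaps k × SphMaps k) × SqSphMaps k, SphMaps k × SphMaps k × SqSphMaps k)))
      {((PointedMap.const _ _, PointedMap.const _ _), PointedMap.const _ _)} ∧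
    (∀ α : SphMaps k, ∃ e : SqSphMaps k ≃ₕ SqSphMaps k, ∀ f, e f = theta hk (α, f)) ∧
    (∀ f g : SqSphMaps k, ∃ α : SphMaps k,
      ∃ e : connectedComponent f ≃ₕ connectedComponent g,
        ∀ h : connectedComponent f, (e h : SqSphMaps k) = theta hk (α, (h : SqSphMaps k))) := by
  have hm := odd_ne_zero hk
  have hn : (2 * k - 1) + (2 * k - 1) ≠ 0 := by omega
  refine ⟨SqSph.pinchAction_const hm _, SqSph.pinchAction_mul hm hn _,
    fun α => ⟨SqSph.actEquiv hm hn α, fun f => rfl⟩, fun f g => ?_⟩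
  -- The only use of the target being `S^(2k)`, apart from its points being closed: `2k - 1 < 2k`
  -- makes the restrictions to the axes nullhomotopic.
  obtain ⟨α, hα⟩ := SqSph.exists_joined_act hm hn
    (SqSph.exists_joined_act_const hm fun f hf => Sph.homotopicRel_const hm (by omega) f hf) f g
  exact ⟨α, (SqSph.actEquiv hm hn α).restrictComponent hα.connectedComponent_eq, fun h => rfl⟩
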